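/- Let $N\ge 2$ and $P(\xi)=\xi_1^2-\xi_2^2\pm\xi_3^2\pm\cdots\pm\xi_N^2$ on $\mathbb{R}^N$, with any fixed choice of the signs. For $f\in L^2(\mathbb{R}^N)$ and $t\in\mathbb{R}$ let $e^{itP(D)}f\in L^2(\mathbb{R}^N)$ be the function whose Fourier transform is $e^{itP(\xi)}\hat f(\xi)$, where $\hat f(\xi)=(2\pi)^{-N}\int_{\mathbb{R}^N}e^{-ix\cdot\xi}f(x)\,dx$ (extended to $L^2$ by continuity); that is, formally, $e^{itP(D)}f(x)=\int_{\mathbb{R}^N}e^{ix\cdot\xi+itP(\xi)}\hat f(\xi)\,d\xi$. For $s>0$ let $H^s(\mathbb{R}^N)$ be the space of all $f\in L^2(\mathbb{R}^N)$ with $(1+|\xi|^2)^{s/2}\hat f\in L^2(\mathbb{R}^N)$. Let $0<s<\frac12$, and let $(t_n)_{n\ge1}\subset(0,1)$ be a decreasing sequence converging to $0$ such that the sequence of gaps $(t_n-t_{n+1})_{n\ge1}$ is decreasing. Then $$\lim_{n\to\infty}e^{it_nP(D)}f(x)=f(x)\quad\text{for a.e. }x\in\mathbb{R}^N$$ holds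 for all $f\in H^s(\mathbb{R}^N)$ if and only if $(t_n)\in\ell^{r(s),\infty}(\mathbb{N})$ with $r(s)=\frac{s}{1-s}$, i.e. if and only if $$\sup_{b>0}\,b^{s/(1-s)}\,\#\{n:\,t_n>b\}<\infty .$$ -/

import Mathlib

open MeasureTheory Filter Topology FourierTransform
open scoped ENNReal

namespace NonellipticSchrodinger

/-- The weak Lorentz sequence space `ℓ^{r,∞}(ℕ)` for sequences of positive numbers:
`sup_{b > 0} b ^ r * #{n : t n > b} < ∞`. The supremum is taken in `[0, ∞]`, and an infinite
set has cardinality `∞`. -/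
def MemWeakEll (r : ℝ) (t : ℕ → ℝ) : Prop :=
  (⨆ b : Set.Ioi (0 : ℝ),
    ENNReal.ofReal ((b : ℝ) ^ r) * (({n : ℕ | (b : ℝ) < t n}.encard : ℕ∞) : ℝ≥0∞)) < ⊤

/-- The diagonal quadratic form `P(ξ) = ∑ i, ε i * ξ i ^ 2` with signs `ε i ∈ {1, -1}`. -/
noncomputable def signedSymbol {N : ℕ} (ε : Fin N → ℤˣ) : C(EuclideanSpace ℝ (Fin N), ℝ) where
  toFun ξ := ∑ i, (((ε i : ℤˣ) : ℤ) : ℝ) * ξ i ^ 2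
  continuous_toFun := by fun_prop

/-- The Fourier multiplier `exp (i t P(2 π ξ))` of `e^{itP(D)}`. Here `D = -i∇`, and Mathlib's
Fourier transform has the kernel `exp (-2 π i x·ξ)`, so that `D` is multiplication by `2 π ξ`
on the Fourier side. -/
noncomputable def schrodingerMultiplier {N : ℕ} (P : C(EuclideanSpace ℝ (Fin N), ℝ)) (t : ℝ)
    (ξ : EuclideanSpace ℝ (Fin N)) : ℂ :=
  Complex.exp (Complex.I * ((t * P ((2 * Real.pi) • ξ) : ℝ) : ℂ))

theorem memLp_schrodingerMultiplier_mul {N : ℕ} (P : C(EuclideanSpace ℝ (Fin N), ℝ)) (t : ℝ)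
    (g : Lp ℂ 2 (volume : Measure (EuclideanSpace ℝ (Fin N)))) :
    MemLp (fun ξ => schrodingerMultiplier P t ξ * g ξ) 2 volume := by
  have hc : Continuous (schrodingerMultiplier P t) := by
    unfold schrodingerMultiplier
    have := P.continuous
    fun_prop
  refine (Lp.memLp g).of_le (hc.aestronglyMeasurable.mul (Lp.aestronglyMeasurable g)) ?_
  refine Filter.Eventually.of_forall fun ξ => ?_
  have h1 : ‖schrodingerMultiplier P t ξ‖ = 1 := by
    rw [schrodingerMultiplier, mul_comm]
    exact Complex.norm_exp_ofReal_mul_I _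
  rw [norm_mul, h1, one_mul]

/-- The Schrödinger mean `e^{itP(D)} f` of `f ∈ L²(ℝ^N)`: the unitary operator on `L²` given by
`f ↦ 𝓕⁻¹ (exp (i t P(2 π ξ)) * 𝓕 f)`, with the Fourier transform of `L²`. -/
noncomputable def schrodingerMean {N : ℕ} (P : C(EuclideanSpace ℝ (Fin N), ℝ)) (t : ℝ)
    (f : Lp ℂ 2 (volume : Measure (EuclideanSpace ℝ (Fin N)))) :
    Lp ℂ 2 (volume : Measure (EuclideanSpace ℝ (Fin N))) :=
  𝓕⁻ ((memLp_schrodingerMultiplier_mul P t (𝓕 f)).toLp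
    (fun ξ => schrodingerMultiplier P t ξ * (𝓕 f) ξ))

/-- `f ∈ L²(ℝ^N)` belongs to the Sobolev space `H^s(ℝ^N)`. -/
def MemHs {N : ℕ} (s : ℝ) (f : Lp ℂ 2 (volume : Measure (EuclideanSpace ℝ (Fin N)))) : Prop :=
  TemperedDistribution.MemSobolev s 2 (Lp.toTemperedDistribution f)

end NonellipticSchrodinger

/-! Write `r = s / (1 - s)`, so that `r * (1 - s) = s`.

Sufficiency. A time `t n` of size `2 ^ (-j)` is paired with the squared frequency radius `q ^ j`,
where `q = 2 ^ (1 / (1 - s))`, and `f` is split there. For the high part no cancellation is used: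
the squared norms are summed over all `n`. A frequency `ξ` is counted only for those `n` with `t n`
above a multiple of `(1 + ‖ξ‖²) ^ (-(1 - s))`, and weak `ℓ^r` bounds their number by a multiple of
`(1 + ‖ξ‖²) ^ s`, the Sobolev weight (`tsum_high_ne_top`). For the low part, the squared maximal
function of `e^{iτP(D)}g - g` over times at most `T` has integral at most a multiple of `T * Q *
‖g‖²` if `g` has frequencies `‖ξ‖² ≤ Q` (`exists_majorant_of_bandlimited`). With `T = 2 ^ (-j)` and
`Q = q ^ i`, the factor is `2 ^ (-(j - i)) * (q / 2) ^ i`, where `q / 2 = q ^ s` is again the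
Sobolev weight and the decay in `j - i` makes everything summable (`exists_majorant_low`).

Necessity. Convergence for all data forces a uniform bound in measure for the maximal function
(`exists_maximalLE_of_ae_bounded`). Outside weak `ℓ^r` some window `(b, 2b]` holds far more than `b
^ (-r)` terms, and monotone gaps make all later times equally dense (`exists_phase_near_int`). The
data are `K` unit frequency balls centred on an arithmetic progression parallel to a null direction
of `P`. There the phase is affine in the index of the ball, so every `x` near the origin has some `t
n ≤ b` that nearly aligns all `K` balls (`exists_focusing_data`). The solution then has size of
order `1`, while the squared `H^s` norm is of order `(K / b) ^ s / K`, which is made arbitrarily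
small (`exists_counterexample_params`). -/

namespace NonellipticSchrodinger

/-! ### The Fourier transform on `L²`. -/

section FourierL2

variable {E : Type*} [NormedAddCommGroup E] [InnerProductSpace ℝ E] [FiniteDimensional ℝ E]
  [MeasurableSpace E] [BorelSpace E]

theorem toTemperedDistribution_injective {p : ℝ≥0∞} [Fact (1 ≤ p)] {f g : Lp ℂ p (volume : Measure E)}
    (h : Lp.toTemperedDistribution f = Lp.toTemperedDistribution g) : f = g := by
  have hk := Lp.ker_toTemperedDistributionCLM_eq_bot (E := E) (F := ℂ) (μ := volume) (p := p)
  exact LinearMap.ker_eq_bot.mp hk h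

/-- The inverse Fourier transform on `L²` of an integrable function is the classical one. -/
theorem coeFn_fourierInv_toLp {g : E → ℂ} (hg : MemLp g 2 volume) (hg1 : Integrable g) :
    ((𝓕⁻ (hg.toLp g) : Lp ℂ 2 (volume : Measure E)) : E → ℂ) =ᵐ[volume] 𝓕⁻ g := by
  have hL : Continuous fun p : E × E => (-innerₗ E) p.1 p.2 := by
    simp only [LinearMap.neg_apply, innerₗ_apply_apply]
    fun_prop
  have hcont : Continuous (𝓕⁻ g) :=
    VectorFourier.fourierIntegral_continuous Real.continuous_fourierChar hL hg1
  refine ae_eq_of_integral_contDiff_smul_eq ?_ hcont.locallyIntegrable ?_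
  · exact (Lp.memLp _).locallyIntegrable (by norm_num)
  intro φ hφ hφc
  have h₁ : HasCompactSupport (Complex.ofRealCLM ∘ φ) := hφc.comp_left rfl
  have h₂ : ContDiff ℝ ((⊤ : ℕ∞) : WithTop ℕ∞) (Complex.ofRealCLM ∘ φ) := by fun_prop
  set Φ := h₁.toSchwartzMap h₂ with hΦ
  have e1 : ∫ x, φ x • (𝓕⁻ (hg.toLp g) : Lp ℂ 2 (volume : Measure E)) x
      = Lp.toTemperedDistribution (𝓕⁻ (hg.toLp g) : Lp ℂ 2 (volume : Measure E)) Φ := by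
    rw [Lp.toTemperedDistribution_apply]
    rfl
  rw [e1, ← Lp.fourierInv_toTemperedDistribution_eq, TemperedDistribution.fourierInv_apply,
    Lp.toTemperedDistribution_apply]
  have e2 : ∫ x, (𝓕⁻ Φ) x • (hg.toLp g) x = ∫ x, (𝓕⁻ (Φ : E → ℂ)) x • g x := by
    refine integral_congr_ae ?_
    filter_upwards [hg.coeFn_toLp] with x hx
    rw [hx, SchwartzMap.fourierInv_coe]
  rw [e2]
  -- Self-adjointness moves the transform from the test function to `g`; this is where integrability
  -- of `g` enters.
  have := VectorFourier.integral_fourierIntegral_smul_eq_flip (e := Real.fourierChar)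
    (L := -innerₗ E) (μ := volume) (ν := volume) (f := (Φ : E → ℂ)) (g := g)
    Real.continuous_fourierChar hL Φ.integrable hg1
  have hflip : (-innerₗ E).flip = -innerₗ E := by
    ext x y; simp [real_inner_comm]
  rw [hflip] at this
  exact this

theorem fourier_injective {f g : Lp ℂ 2 (volume : Measure E)}
    (h : (𝓕 f : Lp ℂ 2 (volume : Measure E)) = 𝓕 g) : f = g :=
  (Lp.fourierTransformₗᵢ E ℂ).injective h

theorem fourier_sub_Lp (f g : Lp ℂ 2 (volume : Measure E)) :
    (𝓕 (f - g) : Lp ℂ 2 (volume : Measure E)) = 𝓕 f - 𝓕 g :=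
  map_sub (Lp.fourierTransformₗᵢ E ℂ) f g

theorem norm_le_of_fourier_le {f g : Lp ℂ 2 (volume : Measure E)} {c : ℝ}
    (h : ∀ᵐ ξ, ‖(𝓕 f : Lp ℂ 2 (volume : Measure E)) ξ‖
      ≤ c * ‖(𝓕 g : Lp ℂ 2 (volume : Measure E)) ξ‖) : ‖f‖ ≤ c * ‖g‖ := by
  rw [← Lp.norm_fourier_eq f, ← Lp.norm_fourier_eq g]
  exact Lp.norm_le_mul_norm_of_ae_le_mul h

theorem enorm_sq_eq_lintegral {α : Type*} [MeasurableSpace α] {μ : Measure α}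
    (f : Lp ℂ 2 μ) : ‖f‖ₑ ^ 2 = ∫⁻ x, ‖f x‖ₑ ^ 2 ∂μ := by
  rw [Lp.enorm_def]
  have := eLpNorm_nnreal_pow_eq_lintegral (μ := μ) (f := f) (p := 2) (by norm_num)
  simpa using this

end FourierL2

/-! ### Sobolev membership in terms of `L²` functions. -/

section Sobolev

variable {N : ℕ}

/-- For `s ≥ 0` the weight with exponent `-s / 2` is bounded and acts on `L²`, while its inverse
acts only on distributions. Putting the weight on `h` therefore gives a pointwise a.e. description,
and `‖h‖` serves as the `H^s` norm. -/
theorem memHs_iff {s : ℝ} (hs : 0 ≤ s) (f : Lp ℂ 2 (volume : Measure (EuclideanSpace ℝ (Fin N)))) :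
    MemHs s f ↔ ∃ h : Lp ℂ 2 (volume : Measure (EuclideanSpace ℝ (Fin N))),
      ((𝓕 f : Lp ℂ 2 (volume : Measure (EuclideanSpace ℝ (Fin N)))) : _ → ℂ) =ᵐ[volume]
        fun ξ => (((1 + ‖ξ‖ ^ 2) ^ (-s / 2) : ℝ) : ℂ) * h ξ := by
  set w : EuclideanSpace ℝ (Fin N) → ℂ := fun ξ => (((1 + ‖ξ‖ ^ 2) ^ (-s / 2) : ℝ) : ℂ) with hw
  have hwt : w.HasTemperateGrowth := by fun_prop
  have hwm : MemLp w ⊤ (volume : Measure (EuclideanSpace ℝ (Fin N))) := by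
    refine memLp_top_of_bound hwt.1.continuous.aestronglyMeasurable 1 (Eventually.of_forall ?_)
    intro ξ
    rw [hw, Complex.norm_real, Real.norm_eq_abs, abs_of_nonneg (by positivity)]
    exact Real.rpow_le_one_of_one_le_of_nonpos (by nlinarith [sq_nonneg ‖ξ‖]) (by linarith)
  have hww : ((fun x : EuclideanSpace ℝ (Fin N) => (((1 + ‖x‖ ^ 2) ^ (s / 2) : ℝ) : ℂ)) * w)
      = fun _ => 1 := by
    ext x
    simp only [hw, Pi.mul_apply]
    rw [← Complex.ofReal_mul, ← Real.rpow_add (by positivity)]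
    simp [neg_div]
  have key : ∀ h : Lp ℂ 2 (volume : Measure (EuclideanSpace ℝ (Fin N))),
      (TemperedDistribution.smulLeftCLM ℂ
        (fun x : EuclideanSpace ℝ (Fin N) => (((1 + ‖x‖ ^ 2) ^ (s / 2) : ℝ) : ℂ))
        (𝓕 (Lp.toTemperedDistribution f)) = Lp.toTemperedDistribution h) ↔
      (𝓕 f : Lp ℂ 2 (volume : Measure (EuclideanSpace ℝ (Fin N))))
        = ((hwm.toLp w) • h : Lp ℂ 2 (volume : Measure (EuclideanSpace ℝ (Fin N)))) := by
    intro h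
    rw [Lp.fourier_toTemperedDistribution_eq]
    constructor
    · intro H
      apply toTemperedDistribution_injective
      rw [Lp.toTemperedDistribution_smul_eq hwt hwm, ← H,
        TemperedDistribution.smulLeftCLM_smulLeftCLM_apply (by fun_prop) hwt]
      rw [hww, TemperedDistribution.smulLeftCLM_const, one_smul]
    · intro H
      rw [H, Lp.toTemperedDistribution_smul_eq hwt hwm,
        TemperedDistribution.smulLeftCLM_smulLeftCLM_apply hwt (by fun_prop)]
      rw [mul_comm, hww, TemperedDistribution.smulLeftCLM_const, one_smul]
  rw [MemHs, TemperedDistribution.memSobolev_iff_exists_smulLeftCLM_fourier]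
  refine exists_congr fun h => ?_
  rw [key h]
  have hae : (((hwm.toLp w) • h : Lp ℂ 2 (volume : Measure (EuclideanSpace ℝ (Fin N)))) : _ → ℂ)
      =ᵐ[volume] fun ξ => w ξ * h ξ := by
    filter_upwards [Lp.coeFn_lpSMul (r := 2) (hwm.toLp w) h, hwm.coeFn_toLp] with x h1 h2
    rw [h1, Pi.smul_apply', h2, smul_eq_mul]
  constructor
  · intro H
    rw [H]
    exact hae
  · intro H
    exact Lp.ext (H.trans hae.symm)

end Sobolev

/-! ### The propagator as an isometry, and its regularity in time. -/

section Mean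

variable {N : ℕ}

local notation "𝔼" => EuclideanSpace ℝ (Fin N)
local notation "L2" => Lp ℂ 2 (volume : Measure (EuclideanSpace ℝ (Fin N)))

theorem norm_schrodingerMultiplier (P : C(𝔼, ℝ)) (t : ℝ) (ξ : 𝔼) :
    ‖schrodingerMultiplier P t ξ‖ = 1 := by
  rw [schrodingerMultiplier, mul_comm]
  exact Complex.norm_exp_ofReal_mul_I _

theorem fourier_schrodingerMean (P : C(𝔼, ℝ)) (t : ℝ) (f : L2) :
    ((𝓕 (schrodingerMean P t f) : L2) : 𝔼 → ℂ) =ᵐ[volume]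
      fun ξ => schrodingerMultiplier P t ξ * (𝓕 f : L2) ξ := by
  rw [schrodingerMean, fourier_fourierInv_eq]
  exact MemLp.coeFn_toLp _

theorem schrodingerMean_add (P : C(𝔼, ℝ)) (t : ℝ) (f g : L2) :
    schrodingerMean P t (f + g) = schrodingerMean P t f + schrodingerMean P t g := by
  apply fourier_injective
  apply Lp.ext
  rw [FourierTransform.fourier_add (schrodingerMean P t f)]
  filter_upwards [fourier_schrodingerMean P t f, fourier_schrodingerMean P t g,
    fourier_schrodingerMean P t (f + g), Lp.coeFn_add (𝓕 f : L2) (𝓕 g),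
    Lp.coeFn_add (𝓕 (schrodingerMean P t f) : L2) (𝓕 (schrodingerMean P t g))] with ξ h1 h2 h3 h4 h5
  rw [h3, h5, Pi.add_apply, h1, h2, FourierTransform.fourier_add f, h4, Pi.add_apply, mul_add]

theorem schrodingerMean_smul (P : C(𝔼, ℝ)) (t : ℝ) (c : ℂ) (f : L2) :
    schrodingerMean P t (c • f) = c • schrodingerMean P t f := by
  apply fourier_injective
  apply Lp.ext
  rw [fourier_smul]
  filter_upwards [fourier_schrodingerMean P t f,
    fourier_schrodingerMean P t (c • f), Lp.coeFn_smul c (𝓕 f : L2),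
    Lp.coeFn_smul c (𝓕 (schrodingerMean P t f) : L2)] with ξ h1 h3 h4 h5
  rw [h3, h5, Pi.smul_apply, h1, fourier_smul, h4, Pi.smul_apply, smul_eq_mul, smul_eq_mul]
  ring

theorem norm_schrodingerMean (P : C(𝔼, ℝ)) (t : ℝ) (f : L2) :
    ‖schrodingerMean P t f‖ = ‖f‖ := by
  rw [← Lp.norm_fourier_eq (schrodingerMean P t f), ← Lp.norm_fourier_eq f]
  simp only [Lp.norm_def]
  congr 1
  refine eLpNorm_congr_norm_ae ?_
  filter_upwards [fourier_schrodingerMean P t f] with ξ h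
  rw [h, norm_mul, norm_schrodingerMultiplier, one_mul]

/-- `e^{itP(D)}` as a linear isometry of `L²`. -/
noncomputable def schrodingerIsometry (P : C(𝔼, ℝ)) (t : ℝ) : L2 →ₗᵢ[ℂ] L2 where
  toFun := schrodingerMean P t
  map_add' := schrodingerMean_add P t
  map_smul' := schrodingerMean_smul P t
  norm_map' := norm_schrodingerMean P t

@[simp]
theorem schrodingerIsometry_apply (P : C(𝔼, ℝ)) (t : ℝ) (f : L2) :
    schrodingerIsometry P t f = schrodingerMean P t f := rfl

theorem norm_schrodingerMultiplier_sub_le (P : C(𝔼, ℝ)) (t τ : ℝ) (ξ : 𝔼) :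
    ‖schrodingerMultiplier P t ξ - schrodingerMultiplier P τ ξ‖
      ≤ |t - τ| * |P ((2 * Real.pi) • ξ)| := by
  have h : schrodingerMultiplier P t ξ - schrodingerMultiplier P τ ξ
      = schrodingerMultiplier P τ ξ *
        (Complex.exp (Complex.I * (((t - τ) * P ((2 * Real.pi) • ξ) : ℝ) : ℂ)) - 1) := by
    simp only [schrodingerMultiplier, mul_sub, ← Complex.exp_add, mul_one]
    congr 2
    push_cast
    ring
  rw [h, norm_mul, norm_schrodingerMultiplier, one_mul, ← abs_mul]
  exact Real.norm_exp_I_mul_ofReal_sub_one_le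

theorem abs_signedSymbol_le (ε : Fin N → ℤˣ) (ξ : 𝔼) : |signedSymbol ε ξ| ≤ ‖ξ‖ ^ 2 := by
  rw [EuclideanSpace.norm_sq_eq]
  change |∑ i, (((ε i : ℤˣ) : ℤ) : ℝ) * ξ i ^ 2| ≤ _
  refine (Finset.abs_sum_le_sum_abs _ _).trans (Finset.sum_le_sum fun i _ => ?_)
  rcases Int.units_eq_one_or (ε i) with h | h <;> simp [h]

/-- Bernstein's inequality in time: on the spectrum of `g` the phase `P (2πξ)` is at most `(2π)² Q`
in absolute value. -/
theorem norm_schrodingerMean_sub_le (ε : Fin N → ℤˣ) (t τ : ℝ) {Q : ℝ} (g : L2)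
    (hg : ∀ᵐ ξ, Q < ‖ξ‖ ^ 2 → (𝓕 g : L2) ξ = 0) :
    ‖schrodingerMean (signedSymbol ε) t g - schrodingerMean (signedSymbol ε) τ g‖
      ≤ |t - τ| * ((2 * Real.pi) ^ 2 * Q) * ‖g‖ := by
  apply norm_le_of_fourier_le
  rw [fourier_sub_Lp]
  filter_upwards [hg, fourier_schrodingerMean (signedSymbol ε) t g,
    fourier_schrodingerMean (signedSymbol ε) τ g, Lp.coeFn_sub
      (𝓕 (schrodingerMean (signedSymbol ε) t g) : L2) (𝓕 (schrodingerMean (signedSymbol ε) τ g))]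
    with ξ h1 h2 h3 h4
  rw [h4, Pi.sub_apply, h2, h3, ← sub_mul, norm_mul]
  rcases lt_or_ge Q (‖ξ‖ ^ 2) with h | h
  · simp [h1 h]
  · gcongr
    refine (norm_schrodingerMultiplier_sub_le _ _ _ _).trans ?_
    gcongr
    refine (abs_signedSymbol_le _ _).trans ?_
    rw [norm_smul, mul_pow, Real.norm_eq_abs, sq_abs]
    gcongr

theorem schrodingerMean_zero (P : C(𝔼, ℝ)) (f : L2) : schrodingerMean P 0 f = f := by
  apply fourier_injective
  apply Lp.ext
  filter_upwards [fourier_schrodingerMean P 0 f] with ξ h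
  simp [h, schrodingerMultiplier]

end Mean

/-! ### Pointwise and summation inequalities. -/

theorem lintegral_enorm_mul_enorm_le {α : Type*} [MeasurableSpace α] {μ : Measure α}
    (f g : Lp ℂ 2 μ) : ∫⁻ x, ‖f x‖ₑ * ‖g x‖ₑ ∂μ ≤ ‖f‖ₑ * ‖g‖ₑ := by
  have h := ENNReal.lintegral_mul_le_Lp_mul_Lq μ (p := 2) (q := 2) (by
    constructor <;> norm_num) (Lp.aestronglyMeasurable f).enorm (Lp.aestronglyMeasurable g).enorm
  have key : ∀ u : Lp ℂ 2 μ, (∫⁻ x, ‖u x‖ₑ ^ (2 : ℝ) ∂μ) ^ (1 / (2 : ℝ)) = ‖u‖ₑ := by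
    intro u
    have := enorm_sq_eq_lintegral u
    simp only [ENNReal.rpow_two]
    rw [← this, ← ENNReal.rpow_two, ← ENNReal.rpow_mul]
    norm_num
  rw [key, key] at h
  exact h

/-- This is `|a|² - |b|² = (|a| - |b|)(|a| + |b|)`. Telescoped along the times, it bounds a maximal
function using only one factor of the time increment. -/
theorem enorm_sq_le_add (a b : ℂ) : ‖a‖ₑ ^ 2 ≤ ‖b‖ₑ ^ 2 + (‖a - b‖ₑ * ‖a‖ₑ + ‖a - b‖ₑ * ‖b‖ₑ) := by
  have h : ‖a‖₊ ^ 2 ≤ ‖b‖₊ ^ 2 + (‖a - b‖₊ * ‖a‖₊ + ‖a - b‖₊ * ‖b‖₊) := by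
    rw [← NNReal.coe_le_coe]
    push_cast
    nlinarith [norm_sub_norm_le a b, norm_nonneg a, norm_nonneg b]
  simp only [enorm]
  exact_mod_cast h

/-- Cauchy–Schwarz with weights `(3/4) ^ k`, whose sum is `4`. The ratio `4/3` is below `2`, so a
later gain `2 ^ (-(j - i))` still leaves the summable `(2/3) ^ (j - i)`. -/
theorem sum_sq_le_weighted (a : ℕ → ℝ) (j : ℕ) :
    (∑ i ∈ Finset.range (j + 1), a i) ^ 2
      ≤ ∑ i ∈ Finset.range (j + 1), 4 * (4 / 3 : ℝ) ^ (j - i) * a i ^ 2 := by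
  induction j with
  | zero => simp; nlinarith [sq_nonneg (a 0)]
  | succ j ih =>
    rw [Finset.sum_range_succ _ (j + 1), Finset.sum_range_succ _ (j + 1)]
    have h : ∑ i ∈ Finset.range (j + 1), 4 * (4 / 3 : ℝ) ^ (j + 1 - i) * a i ^ 2
        = 4 / 3 * ∑ i ∈ Finset.range (j + 1), 4 * (4 / 3 : ℝ) ^ (j - i) * a i ^ 2 := by
      rw [Finset.mul_sum]
      refine Finset.sum_congr rfl fun i hi => ?_
      rw [Nat.sub_add_comm (by simpa [Nat.lt_succ_iff] using hi), pow_succ]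
      ring
    rw [h]
    set S := ∑ i ∈ Finset.range (j + 1), a i
    simp only [Nat.sub_self, pow_zero]
    nlinarith [sq_nonneg (S - 3 * a (j + 1))]

theorem enorm_sum_sq_le_weighted (a : ℕ → ℂ) (j : ℕ) :
    ‖∑ i ∈ Finset.range (j + 1), a i‖ₑ ^ 2
      ≤ ∑ i ∈ Finset.range (j + 1), ENNReal.ofReal (4 * (4 / 3) ^ (j - i)) * ‖a i‖ₑ ^ 2 := by
  have h : ‖∑ i ∈ Finset.range (j + 1), a i‖ ^ 2
      ≤ ∑ i ∈ Finset.range (j + 1), 4 * (4 / 3 : ℝ) ^ (j - i) * ‖a i‖ ^ 2 := by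
    refine le_trans ?_ (sum_sq_le_weighted (fun i => ‖a i‖) j)
    gcongr
    exact norm_sum_le _ _
  have h2 := ENNReal.ofReal_le_ofReal h
  rw [ENNReal.ofReal_pow (norm_nonneg _), ofReal_norm,
    ENNReal.ofReal_sum_of_nonneg (fun i _ => by positivity)] at h2
  refine h2.trans (le_of_eq (Finset.sum_congr rfl fun i _ => ?_))
  rw [ENNReal.ofReal_mul (by positivity), ENNReal.ofReal_pow (norm_nonneg _), ofReal_norm]

theorem coeFn_sum_range {α : Type*} [MeasurableSpace α] {μ : Measure α} (f : ℕ → Lp ℂ 2 μ) (n : ℕ) :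
    ((∑ i ∈ Finset.range n, f i : Lp ℂ 2 μ) : α → ℂ) =ᵐ[μ] fun x => ∑ i ∈ Finset.range n, f i x := by
  induction n with
  | zero =>
    simp only [Finset.range_zero, Finset.sum_empty]
    exact Lp.coeFn_zero ℂ 2 μ
  | succ n ih =>
    rw [Finset.sum_range_succ]
    filter_upwards [ih, Lp.coeFn_add (∑ i ∈ Finset.range n, f i) (f n)] with x h1 h2
    rw [h2, Pi.add_apply, h1, Finset.sum_range_succ]

theorem tendsto_zero_of_enorm_sq {a : ℕ → ℂ} (h1 : Tendsto (fun n => ‖a n‖ₑ ^ 2) atTop (𝓝 0)) :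
    Tendsto a atTop (𝓝 0) := by
  rw [tendsto_zero_iff_enorm_tendsto_zero]
  have h2 := (ENNReal.continuous_rpow_const (y := (1 / 2 : ℝ))).tendsto 0 |>.comp h1
  rw [ENNReal.zero_rpow_of_pos (by norm_num)] at h2
  refine h2.congr fun n => ?_
  simp only [Function.comp]
  rw [← ENNReal.rpow_natCast, ← ENNReal.rpow_mul]
  norm_num

theorem tendsto_zero_of_tsum_sq_lt_top {a : ℕ → ℂ} (h : ∑' n, ‖a n‖ₑ ^ 2 ≠ ⊤) :
    Tendsto a atTop (𝓝 0) :=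
  tendsto_zero_of_enorm_sq (ENNReal.tendsto_atTop_zero_of_tsum_ne_top h)

/-! ### Maximal estimate for band-limited data; frequency projections. -/

section Chain

variable {N : ℕ}

local notation "𝔼" => EuclideanSpace ℝ (Fin N)
local notation "L2" => Lp ℂ 2 (volume : Measure (EuclideanSpace ℝ (Fin N)))

/-- For a band-limited `g`, the maximal function of `e^{iτP(D)}g - g` over a monotone sequence of
times is controlled in `L²` by the geometric mean of `g` and its time derivative. -/
theorem exists_majorant_of_bandlimited (ε : Fin N → ℤˣ) {τ : ℕ → ℝ} (hτ : Antitone τ)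
    (hτ0 : ∀ n, 0 ≤ τ n) {Q : ℝ} (hQ : 0 ≤ Q) (g : L2)
    (hg : ∀ᵐ ξ, Q < ‖ξ‖ ^ 2 → (𝓕 g : L2) ξ = 0) :
    ∃ X : 𝔼 → ℝ≥0∞, AEMeasurable X ∧
      (∀ᵐ x, ∀ n, ‖(schrodingerMean (signedSymbol ε) (τ n) g - g : L2) x‖ₑ ^ 2 ≤ X x) ∧
      ∫⁻ x, X x ≤ ENNReal.ofReal (6 * ((2 * Real.pi) ^ 2) * τ 0 * Q) * ‖g‖ₑ ^ 2 := by
  set v : ℕ → L2 := fun n => schrodingerMean (signedSymbol ε) (τ n) g - g with hv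
  set A : ℝ := (2 * Real.pi) ^ 2 * Q with hA
  have hA0 : 0 ≤ A := by positivity
  have hvm : ∀ n, AEMeasurable (fun x => ‖v n x‖ₑ) volume :=
    fun n => (Lp.aestronglyMeasurable (v n)).enorm
  have hdm : ∀ n, AEMeasurable (fun x => ‖(v (n + 1) - v n) x‖ₑ) volume :=
    fun n => (Lp.aestronglyMeasurable (v (n + 1) - v n)).enorm
  have hvn : ∀ n, ‖v n‖ₑ ≤ ENNReal.ofReal 2 * ‖g‖ₑ := by
    intro n
    rw [← ofReal_norm, ← ofReal_norm, ← ENNReal.ofReal_mul (by norm_num)]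
    refine ENNReal.ofReal_le_ofReal ((norm_sub_le _ _).trans ?_)
    rw [norm_schrodingerMean]
    linarith
  have hv0 : ‖v 0‖ₑ ≤ ENNReal.ofReal (τ 0 * A) * ‖g‖ₑ := by
    have := norm_schrodingerMean_sub_le ε (τ 0) 0 g hg
    rw [schrodingerMean_zero, sub_zero, abs_of_nonneg (hτ0 0)] at this
    rw [← ofReal_norm, ← ofReal_norm, ← ENNReal.ofReal_mul (mul_nonneg (hτ0 0) hA0)]
    exact ENNReal.ofReal_le_ofReal this
  have hd : ∀ n, ‖v (n + 1) - v n‖ₑ ≤ ENNReal.ofReal ((τ n - τ (n + 1)) * A) * ‖g‖ₑ := by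
    intro n
    have hn : 0 ≤ τ n - τ (n + 1) := sub_nonneg.2 (hτ n.le_succ)
    have := norm_schrodingerMean_sub_le ε (τ (n + 1)) (τ n) g hg
    rw [abs_sub_comm, abs_of_nonneg hn] at this
    rw [← ofReal_norm, ← ofReal_norm, ← ENNReal.ofReal_mul (mul_nonneg hn hA0)]
    simp only [hv, sub_sub_sub_cancel_right]
    exact ENNReal.ofReal_le_ofReal this
  set Y : ℕ → 𝔼 → ℝ≥0∞ := fun m x =>
    ‖(v (m + 1) - v m) x‖ₑ * ‖v (m + 1) x‖ₑ + ‖(v (m + 1) - v m) x‖ₑ * ‖v m x‖ₑ with hY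
  have hYm : ∀ m, AEMeasurable (Y m) volume :=
    fun m => ((hdm m).mul (hvm (m + 1))).add ((hdm m).mul (hvm m))
  have hYi : ∀ m, ∫⁻ x, Y m x ≤ ENNReal.ofReal (τ m - τ (m + 1)) *
      (ENNReal.ofReal (4 * A) * ‖g‖ₑ ^ 2) := by
    intro m
    simp only [hY]
    rw [lintegral_add_left' (show AEMeasurable (fun x => ‖(v (m + 1) - v m) x‖ₑ * ‖v (m + 1) x‖ₑ)
      volume from (hdm m).mul (hvm (m + 1)))]
    refine (add_le_add (lintegral_enorm_mul_enorm_le _ _) (lintegral_enorm_mul_enorm_le _ _)).trans ?_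
    refine (add_le_add (mul_le_mul' (hd m) (hvn _)) (mul_le_mul' (hd m) (hvn _))).trans (le_of_eq ?_)
    rw [ENNReal.ofReal_mul (sub_nonneg.2 (hτ m.le_succ)),
      ENNReal.ofReal_mul (p := 4) (q := A) (by norm_num),
      show (4 : ℝ) = 2 + 2 by norm_num, ENNReal.ofReal_add (by norm_num) (by norm_num)]
    ring
  -- The increments add up to at most `τ 0` however many times there are, so the final bound depends
  -- on the sequence only through its largest term.
  have htel : ∑' m, ENNReal.ofReal (τ m - τ (m + 1)) ≤ ENNReal.ofReal (τ 0) := by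
    rw [ENNReal.tsum_eq_iSup_nat]
    refine iSup_le fun n => ?_
    rw [← ENNReal.ofReal_sum_of_nonneg (fun m _ => sub_nonneg.2 (hτ m.le_succ)),
      Finset.sum_range_sub']
    exact ENNReal.ofReal_le_ofReal (by linarith [hτ0 n])
  refine ⟨fun x => ‖v 0 x‖ₑ ^ 2 + ∑' m, Y m x, ((hvm 0).pow_const 2).add (AEMeasurable.tsum hYm),
    ?_, ?_⟩
  · have hae : ∀ᵐ x, ∀ m, (v (m + 1) - v m) x = v (m + 1) x - v m x :=
      ae_all_iff.2 fun m => by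
        filter_upwards [Lp.coeFn_sub (v (m + 1)) (v m)] with x hx
        rw [hx, Pi.sub_apply]
    filter_upwards [hae] with x hx n
    have : ‖v n x‖ₑ ^ 2 ≤ ‖v 0 x‖ₑ ^ 2 + ∑ m ∈ Finset.range n, Y m x := by
      induction n with
      | zero => simp
      | succ n ih =>
        rw [Finset.sum_range_succ, ← add_assoc]
        refine (enorm_sq_le_add (v (n + 1) x) (v n x)).trans ?_
        simp only [hY, hx]
        simp only [hY, hx] at ih
        gcongr
    exact this.trans (by gcongr; exact ENNReal.sum_le_tsum _)
  · rw [lintegral_add_left' ((hvm 0).pow_const 2), lintegral_tsum hYm, ← enorm_sq_eq_lintegral]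
    have h1 : ‖v 0‖ₑ ^ 2 ≤ ENNReal.ofReal (τ 0) * (ENNReal.ofReal (2 * A) * ‖g‖ₑ ^ 2) := by
      rw [sq]
      refine (mul_le_mul' hv0 (hvn 0)).trans (le_of_eq ?_)
      rw [ENNReal.ofReal_mul (hτ0 0), ENNReal.ofReal_mul zero_le_two (q := A)]
      ring
    have h2 : ∑' m, ∫⁻ x, Y m x ≤ ENNReal.ofReal (τ 0) * (ENNReal.ofReal (4 * A) * ‖g‖ₑ ^ 2) := by
      refine (ENNReal.tsum_le_tsum hYi).trans ?_
      rw [ENNReal.tsum_mul_right]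
      gcongr
    refine (add_le_add h1 h2).trans (le_of_eq ?_)
    rw [← mul_add, ← add_mul, ← ENNReal.ofReal_add (by positivity) (by positivity), ← mul_assoc,
      ← ENNReal.ofReal_mul (hτ0 0), hA]
    congr 2
    ring

/-- The Fourier projection of `f` to frequencies in `S`. -/
noncomputable def fourierRestrict {S : Set 𝔼} (hS : MeasurableSet S) (f : L2) : L2 :=
  𝓕⁻ (((Lp.memLp (𝓕 f : L2)).indicator hS).toLp (S.indicator (𝓕 f : L2)))

theorem fourier_fourierRestrict {S : Set 𝔼} (hS : MeasurableSet S) (f : L2) :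
    ((𝓕 (fourierRestrict hS f) : L2) : 𝔼 → ℂ) =ᵐ[volume] S.indicator (𝓕 f : L2) := by
  rw [fourierRestrict, fourier_fourierInv_eq]
  exact MemLp.coeFn_toLp _

theorem enorm_fourierRestrict_sq {S : Set 𝔼} (hS : MeasurableSet S) (f : L2) :
    ‖fourierRestrict hS f‖ₑ ^ 2 = ∫⁻ ξ in S, ‖(𝓕 f : L2) ξ‖ₑ ^ 2 := by
  have : ‖fourierRestrict hS f‖ₑ = ‖(𝓕 (fourierRestrict hS f) : L2)‖ₑ := by
    rw [← ofReal_norm, ← ofReal_norm, Lp.norm_fourier_eq]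
  rw [this, enorm_sq_eq_lintegral, ← lintegral_indicator hS]
  refine lintegral_congr_ae ?_
  filter_upwards [fourier_fourierRestrict hS f] with ξ h
  rw [h]
  by_cases hξ : ξ ∈ S <;> simp [hξ]

theorem fourierRestrict_add {S T U : Set 𝔼} (hS : MeasurableSet S) (hT : MeasurableSet T)
    (hU : MeasurableSet U) (hd : Disjoint S T) (h : U = S ∪ T) (f : L2) :
    fourierRestrict hU f = fourierRestrict hS f + fourierRestrict hT f := by
  apply fourier_injective
  apply Lp.ext
  rw [FourierTransform.fourier_add]
  filter_upwards [fourier_fourierRestrict hU f, fourier_fourierRestrict hS f,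
    fourier_fourierRestrict hT f,
    Lp.coeFn_add (𝓕 (fourierRestrict hS f) : L2) (𝓕 (fourierRestrict hT f))] with ξ h1 h2 h3 h4
  rw [h1, h4, Pi.add_apply, h2, h3, h, Set.indicator_union_of_disjoint hd]

theorem fourierRestrict_univ (f : L2) : fourierRestrict MeasurableSet.univ f = f := by
  apply fourier_injective
  apply Lp.ext
  filter_upwards [fourier_fourierRestrict MeasurableSet.univ f] with ξ h1
  rw [h1, Set.indicator_univ]

end Chain

/-- The Cauchy product, regrouped along antidiagonals. -/
theorem tsum_sum_range_mul_le (a u : ℕ → ℝ≥0∞) :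
    ∑' j, ∑ i ∈ Finset.range (j + 1), u (j - i) * a i = (∑' m, u m) * ∑' i, a i := by
  have h1 : ∀ j, ∑ i ∈ Finset.range (j + 1), u (j - i) * a i
      = ∑' p : Finset.HasAntidiagonal.antidiagonal j, u p.1.2 * a p.1.1 := by
    intro j
    rw [Finset.tsum_subtype (Finset.HasAntidiagonal.antidiagonal j) (fun p => u p.2 * a p.1),
      Finset.Nat.sum_antidiagonal_eq_sum_range_succ (fun i k => u k * a i)]
  simp_rw [h1]
  rw [← ENNReal.tsum_sigma' (fun p : Σ j, Finset.HasAntidiagonal.antidiagonal j => u p.2.1.2 * a p.2.1.1)]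
  rw [← Finset.HasAntidiagonal.sigmaAntidiagonalEquivProd.symm.tsum_eq]
  simp only [Finset.HasAntidiagonal.sigmaAntidiagonalEquivProd_symm_apply_snd_coe]
  rw [ENNReal.tsum_prod (f := fun i m => u m * a i)]
  simp only [ENNReal.tsum_mul_right, ENNReal.tsum_mul_left]

/-! ### Weak `ℓ^r` implies convergence. -/

section Sufficiency

variable {N : ℕ}

local notation "𝔼" => EuclideanSpace ℝ (Fin N)
local notation "L2" => Lp ℂ 2 (volume : Measure (EuclideanSpace ℝ (Fin N)))

/-- The frequencies with `‖ξ‖² ≤ q ^ j`. -/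
def freqBall (N : ℕ) (q : ℝ) (j : ℕ) : Set (EuclideanSpace ℝ (Fin N)) := {ξ | ‖ξ‖ ^ 2 ≤ q ^ j}

theorem measurableSet_freqBall (q : ℝ) (j : ℕ) : MeasurableSet (freqBall N q j) :=
  measurableSet_le (by fun_prop) measurable_const

/-- The frequency shells `q ^ (i - 1) < ‖ξ‖² ≤ q ^ i`. -/
def freqShell (N : ℕ) (q : ℝ) (i : ℕ) : Set (EuclideanSpace ℝ (Fin N)) := disjointed (freqBall N q) i

theorem measurableSet_freqShell (q : ℝ) (j : ℕ) : MeasurableSet (freqShell N q j) :=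
  MeasurableSet.disjointed (measurableSet_freqBall q) j

theorem monotone_freqBall {q : ℝ} (hq : 1 ≤ q) : Monotone (freqBall N q) := fun _ _ hij _ hξ =>
  le_trans hξ (pow_le_pow_right₀ hq hij)

theorem fourierRestrict_freqBall {q : ℝ} (hq : 1 ≤ q) (f : L2) (j : ℕ) :
    fourierRestrict (measurableSet_freqBall q j) f
      = ∑ i ∈ Finset.range (j + 1), fourierRestrict (measurableSet_freqShell q i) f := by
  induction j with
  | zero =>
    have : freqShell N q 0 = freqBall N q 0 := disjointed_zero _
    simp [this]
  | succ j ih =>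
    rw [Finset.sum_range_succ, ← ih]
    have hd : freqShell N q (j + 1) = freqBall N q (j + 1) \ freqBall N q j :=
      (monotone_freqBall hq).disjointed_add_one j
    refine fourierRestrict_add _ _ _ ?_ ?_ f
    · rw [hd]; exact disjoint_sdiff_self_right
    · rw [hd, Set.union_sdiff_cancel (monotone_freqBall hq j.le_succ)]

theorem pow_le_of_mem_freqShell {q : ℝ} (hq : 1 ≤ q) {i : ℕ} {ξ : 𝔼} (h : ξ ∈ freqShell N q i) :
    q ^ i ≤ q * (1 + ‖ξ‖ ^ 2) := by
  cases i with
  -- The zeroth shell is the whole ball `‖ξ‖² ≤ 1`, without a lower bound on `‖ξ‖`; the summand `1`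
  -- in the claim covers it.
  | zero => nlinarith [sq_nonneg ‖ξ‖]
  | succ i =>
    have hd : freqShell N q (i + 1) = freqBall N q (i + 1) \ freqBall N q i :=
      (monotone_freqBall hq).disjointed_add_one i
    rw [hd] at h
    have h2 : q ^ i < ‖ξ‖ ^ 2 := not_le.1 h.2
    rw [pow_succ]
    nlinarith

/-- The ratio of consecutive squared frequency radii adapted to time scales `2 ^ (-j)`. -/
noncomputable def freqRatio (s : ℝ) : ℝ := 2 ^ (1 / (1 - s))

theorem freqRatio_pos (s : ℝ) : 0 < freqRatio s := by unfold freqRatio; positivity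

theorem one_le_freqRatio {s : ℝ} (hs : s < 1) : 1 ≤ freqRatio s :=
  Real.one_le_rpow one_le_two (by have : 0 < 1 - s := by linarith
                                  positivity)

theorem freqRatio_rpow_one_sub {s : ℝ} (hs : s < 1) : freqRatio s ^ (1 - s) = 2 := by
  rw [freqRatio, ← Real.rpow_mul (by norm_num), one_div, inv_mul_cancel₀ (by linarith), Real.rpow_one]

/-- This identity fixes the choice of `freqRatio`: the loss `q ^ i` against the gain `2 ^ (-i)` is
exactly the Sobolev weight of the `i`-th shell. -/
theorem freqRatio_rpow {s : ℝ} (hs : s < 1) : freqRatio s ^ s = freqRatio s / 2 := by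
  have h := freqRatio_rpow_one_sub hs
  rw [Real.rpow_sub (freqRatio_pos s), Real.rpow_one] at h
  have := Real.rpow_pos_of_pos (freqRatio_pos s) s
  field_simp at h ⊢
  linarith

theorem weight_mul_enorm_sq {s : ℝ} {f h : L2}
    (hf : ((𝓕 f : L2) : 𝔼 → ℂ) =ᵐ[volume] fun ξ => (((1 + ‖ξ‖ ^ 2) ^ (-s / 2) : ℝ) : ℂ) * h ξ) :
    ∀ᵐ ξ, ENNReal.ofReal ((1 + ‖ξ‖ ^ 2) ^ s) * ‖(𝓕 f : L2) ξ‖ₑ ^ 2 = ‖h ξ‖ₑ ^ 2 := by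
  filter_upwards [hf] with ξ hξ
  have h0 : 0 < 1 + ‖ξ‖ ^ 2 := by positivity
  have h1 : ‖(𝓕 f : L2) ξ‖ₑ ^ 2 = ENNReal.ofReal ((1 + ‖ξ‖ ^ 2) ^ (-s)) * ‖h ξ‖ₑ ^ 2 := by
    rw [hξ, enorm_mul, mul_pow]
    congr 1
    rw [← ofReal_norm, Complex.norm_real, Real.norm_eq_abs, abs_of_nonneg (by positivity),
      ← ENNReal.ofReal_pow (by positivity), ← Real.rpow_natCast, ← Real.rpow_mul h0.le]
    congr 2
    push_cast
    ring
  rw [h1, ← mul_assoc, ← ENNReal.ofReal_mul (by positivity), ← Real.rpow_add h0]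
  simp

theorem tsum_freqShell_le {s : ℝ} (hs₀ : 0 < s) (hs₁ : s < 1) {f h : L2}
    (hf : ((𝓕 f : L2) : 𝔼 → ℂ) =ᵐ[volume] fun ξ => (((1 + ‖ξ‖ ^ 2) ^ (-s / 2) : ℝ) : ℂ) * h ξ) :
    ∑' i, ENNReal.ofReal ((freqRatio s / 2) ^ i) *
      ‖fourierRestrict (measurableSet_freqShell (freqRatio s) i) f‖ₑ ^ 2
      ≤ ENNReal.ofReal (freqRatio s ^ s) * ‖h‖ₑ ^ 2 := by
  have hq := one_le_freqRatio hs₁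
  have hq0 := freqRatio_pos s
  have h1 : ∀ i, ENNReal.ofReal ((freqRatio s / 2) ^ i) *
      ‖fourierRestrict (measurableSet_freqShell (freqRatio s) i) f‖ₑ ^ 2
      ≤ ∫⁻ ξ in freqShell N (freqRatio s) i, ENNReal.ofReal (freqRatio s ^ s) * ‖h ξ‖ₑ ^ 2 := by
    intro i
    rw [enorm_fourierRestrict_sq, ← lintegral_const_mul' _ _ ENNReal.ofReal_ne_top]
    refine setLIntegral_mono_ae' (measurableSet_freqShell _ i) ?_
    filter_upwards [weight_mul_enorm_sq hf] with ξ hξ hmem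
    rw [← hξ, ← mul_assoc, ← ENNReal.ofReal_mul (by positivity)]
    gcongr
    rw [← freqRatio_rpow hs₁, ← Real.mul_rpow hq0.le (by positivity), ← Real.rpow_mul_natCast hq0.le,
      mul_comm, Real.rpow_natCast_mul hq0.le]
    exact Real.rpow_le_rpow (by positivity) (pow_le_of_mem_freqShell hq hmem) hs₀.le
  refine (ENNReal.tsum_le_tsum h1).trans ?_
  rw [← lintegral_iUnion (fun i => measurableSet_freqShell _ i) (disjoint_disjointed _)]
  refine (setLIntegral_le_lintegral _ _).trans (le_of_eq ?_)
  rw [lintegral_const_mul' _ _ ENNReal.ofReal_ne_top, enorm_sq_eq_lintegral]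

/-- By monotonicity the times at most `T` form a tail of the sequence, and its first term is at most
`T`. -/
theorem exists_majorant_of_le_time (ε : Fin N → ℤˣ) {t : ℕ → ℝ} (ht : Antitone t)
    (ht0 : ∀ n, 0 ≤ t n) {Q T : ℝ} (hQ : 0 ≤ Q) (hT : ∃ n, t n ≤ T) (g : L2)
    (hg : ∀ᵐ ξ, Q < ‖ξ‖ ^ 2 → (𝓕 g : L2) ξ = 0) :
    ∃ X : 𝔼 → ℝ≥0∞, AEMeasurable X ∧
      (∀ᵐ x, ∀ n, t n ≤ T → ‖(schrodingerMean (signedSymbol ε) (t n) g - g : L2) x‖ₑ ^ 2 ≤ X x) ∧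
      ∫⁻ x, X x ≤ ENNReal.ofReal (6 * ((2 * Real.pi) ^ 2) * T * Q) * ‖g‖ₑ ^ 2 := by
  classical
  set n₀ := Nat.find hT with hn₀
  obtain ⟨X, hX, hX1, hX2⟩ := exists_majorant_of_bandlimited ε (τ := fun m => t (n₀ + m))
    (fun a b hab => ht (by omega)) (fun n => ht0 _) hQ g hg
  refine ⟨X, hX, ?_, hX2.trans ?_⟩
  · filter_upwards [hX1] with x hx n hn
    have := hx (n - n₀)
    rwa [Nat.add_sub_cancel' (Nat.find_min' hT hn)] at this
  · gcongr
    exact Nat.find_spec hT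

/-- Finiteness of `∑' j, Z j x` is stronger than a maximal bound: it gives `Z j x → 0`, hence
convergence of the low parts without a density argument. -/
theorem exists_majorant_low {s : ℝ} (hs₀ : 0 < s) (hs₁ : s < 1) (ε : Fin N → ℤˣ) {t : ℕ → ℝ}
    (ht : Antitone t) (ht0 : ∀ n, 0 ≤ t n) (ht_lim : Tendsto t atTop (𝓝 0)) {f h : L2}
    (hf : ((𝓕 f : L2) : 𝔼 → ℂ) =ᵐ[volume] fun ξ => (((1 + ‖ξ‖ ^ 2) ^ (-s / 2) : ℝ) : ℂ) * h ξ) :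
    ∃ Z : ℕ → 𝔼 → ℝ≥0∞, (∀ᵐ x, ∑' j, Z j x ≠ ⊤) ∧
      ∀ᵐ x, ∀ j n, t n ≤ (1 / 2) ^ j →
        ‖(schrodingerMean (signedSymbol ε) (t n)
            (fourierRestrict (measurableSet_freqBall (freqRatio s) j) f)
          - fourierRestrict (measurableSet_freqBall (freqRatio s) j) f : L2) x‖ₑ ^ 2 ≤ Z j x := by
  set q := freqRatio s with hqdef
  have hq := one_le_freqRatio hs₁
  have hq0 : 0 < q := freqRatio_pos s
  set F : ℕ → L2 := fun i => fourierRestrict (measurableSet_freqShell q i) f with hF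
  have hFb : ∀ i, ∀ᵐ ξ, q ^ i < ‖ξ‖ ^ 2 → (𝓕 (F i) : L2) ξ = 0 := by
    intro i
    filter_upwards [fourier_fourierRestrict (measurableSet_freqShell q i) f] with ξ hξ hlt
    rw [hξ, Set.indicator_of_notMem]
    exact fun hmem => absurd (disjointed_subset (freqBall N q) i hmem) (not_le.2 hlt)
  have hT : ∀ j : ℕ, ∃ n, t n ≤ (1 / 2 : ℝ) ^ j := fun j =>
    (ht_lim.eventually (Iic_mem_nhds (show (0 : ℝ) < (1 / 2) ^ j by positivity))).exists
  choose X hXm hX1 hX2 using fun i j : ℕ =>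
    exists_majorant_of_le_time ε ht ht0 (pow_nonneg hq0.le i) (hT j) (F i) (hFb i)
  set Z : ℕ → 𝔼 → ℝ≥0∞ := fun j x =>
    ∑ i ∈ Finset.range (j + 1), ENNReal.ofReal (4 * (4 / 3) ^ (j - i)) * X i j x with hZ
  have hZm : ∀ j, AEMeasurable (Z j) := fun j =>
    Finset.aemeasurable_fun_sum _ fun i _ => (hXm i j).const_mul _
  refine ⟨Z, ?_, ?_⟩
  · have hint : ∫⁻ x, ∑' j, Z j x ≠ ⊤ := by
      rw [lintegral_tsum hZm]
      set c : ℝ := 4 * (6 * (2 * Real.pi) ^ 2) with hc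
      have hc0 : 0 ≤ c := by positivity
      have hZi : ∀ j, ∫⁻ x, Z j x ≤ ∑ i ∈ Finset.range (j + 1),
          ENNReal.ofReal (c * (2 / 3) ^ (j - i)) * (ENNReal.ofReal ((q / 2) ^ i) * ‖F i‖ₑ ^ 2) := by
        intro j
        simp only [hZ]
        rw [lintegral_finsetSum' _ fun i _ => (hXm i j).const_mul _]
        refine Finset.sum_le_sum fun i hi => ?_
        rw [lintegral_const_mul' _ _ ENNReal.ofReal_ne_top]
        refine (mul_le_mul_right (hX2 i j) _).trans (le_of_eq ?_)
        rw [← mul_assoc, ← mul_assoc, ← ENNReal.ofReal_mul (by positivity),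
          ← ENNReal.ofReal_mul (by positivity)]
        congr 2
        -- With `j = i + m`: `(4/3) ^ m * 2 ^ (-(i + m)) * q ^ i = (2/3) ^ m * (q / 2) ^ i`.
        obtain ⟨m, rfl⟩ : ∃ m, j = i + m := ⟨j - i, by have := Finset.mem_range.1 hi; omega⟩
        rw [Nat.add_sub_cancel_left, pow_add, div_pow q, hc,
          show (4 / 3 : ℝ) = 2 * (2 / 3) by norm_num, mul_pow 2 (2 / 3 : ℝ), one_div, inv_pow, inv_pow]
        field_simp
      refine ne_top_of_le_ne_top ?_ (ENNReal.tsum_le_tsum hZi)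
      rw [tsum_sum_range_mul_le (fun i => ENNReal.ofReal ((q / 2) ^ i) * ‖F i‖ₑ ^ 2)
        (fun m => ENNReal.ofReal (c * (2 / 3) ^ m))]
      refine ENNReal.mul_ne_top ?_ ?_
      · have hsum : Summable fun m : ℕ => c * (2 / 3 : ℝ) ^ m :=
          (summable_geometric_of_lt_one (by norm_num) (by norm_num)).mul_left c
        exact hsum.tsum_ofReal_ne_top
      · refine ne_top_of_le_ne_top ?_ (tsum_freqShell_le hs₀ hs₁ hf)
        exact ENNReal.mul_ne_top ENNReal.ofReal_ne_top (by simp)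
    exact (ae_lt_top' (AEMeasurable.tsum hZm) hint).mono fun x hx => hx.ne
  · have hX1' : ∀ᵐ x, ∀ i j n, t n ≤ (1 / 2) ^ j →
        ‖(schrodingerMean (signedSymbol ε) (t n) (F i) - F i : L2) x‖ₑ ^ 2 ≤ X i j x :=
      ae_all_iff.2 fun i => ae_all_iff.2 fun j => hX1 i j
    have hsum : ∀ᵐ x, ∀ j n, (schrodingerMean (signedSymbol ε) (t n)
          (fourierRestrict (measurableSet_freqBall q j) f)
          - fourierRestrict (measurableSet_freqBall q j) f : L2) x
        = ∑ i ∈ Finset.range (j + 1),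
          (schrodingerMean (signedSymbol ε) (t n) (F i) - F i : L2) x := by
      refine ae_all_iff.2 fun j => ae_all_iff.2 fun n => ?_
      have h1 : (schrodingerMean (signedSymbol ε) (t n)
          (fourierRestrict (measurableSet_freqBall q j) f)
          - fourierRestrict (measurableSet_freqBall q j) f : L2)
          = ∑ i ∈ Finset.range (j + 1), (schrodingerMean (signedSymbol ε) (t n) (F i) - F i : L2) := by
        rw [fourierRestrict_freqBall hq, ← schrodingerIsometry_apply, map_sum, Finset.sum_sub_distrib]
        rfl
      rw [h1]
      exact coeFn_sum_range _ _
    filter_upwards [hX1', hsum] with x hx hs j n hn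
    rw [hs]
    refine (enorm_sum_sq_le_weighted _ j).trans ?_
    simp only [hZ]
    gcongr with i hi
    exact hx i j n hn

/-- Exchanging sum and integral puts in front of `|𝓕 f ξ|²` the number of `n` whose cut-off lies
below `ξ`; the weak `ℓ^r` bound turns this number into the Sobolev weight. -/
theorem tsum_high_ne_top {s : ℝ} (hs₀ : 0 < s) (hs₁ : s < 1) {t : ℕ → ℝ} {f h : L2}
    (hf : ((𝓕 f : L2) : 𝔼 → ℂ) =ᵐ[volume] fun ξ => (((1 + ‖ξ‖ ^ 2) ^ (-s / 2) : ℝ) : ℂ) * h ξ)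
    (hw : MemWeakEll (s / (1 - s)) t) {j : ℕ → ℕ} (hj : ∀ n, (1 / 2) ^ (j n + 1) < t n) :
    ∑' n, ‖fourierRestrict (measurableSet_freqBall (freqRatio s) (j n)).compl f‖ₑ ^ 2 ≠ ⊤ := by
  set q := freqRatio s with hqdef
  have hq0 : 0 < q := freqRatio_pos s
  have hs1 : 0 < 1 - s := by linarith
  set r := s / (1 - s) with hr
  have hr0 : 0 < r := by positivity
  set C := ⨆ b : Set.Ioi (0 : ℝ),
    ENNReal.ofReal ((b : ℝ) ^ r) * (({n : ℕ | (b : ℝ) < t n}.encard : ℕ∞) : ℝ≥0∞) with hC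
  have hCtop : C ≠ ⊤ := hw.ne
  have hcount : ∀ ξ : 𝔼, ∑' n, ((freqBall N q (j n))ᶜ).indicator (1 : 𝔼 → ℝ≥0∞) ξ
      ≤ C * ENNReal.ofReal (2 ^ r) * ENNReal.ofReal ((1 + ‖ξ‖ ^ 2) ^ s) := by
    intro ξ
    set Y := 1 + ‖ξ‖ ^ 2 with hY
    have hY0 : 0 < Y := by positivity
    -- `q ^ (j n) < Y` means `2 ^ (-j n) > Y ^ (-(1 - s))`, and the half comes from the exponent `j
    -- n + 1` in `hj`.
    set b := Y ^ (-(1 - s)) / 2 with hb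
    have hb0 : 0 < b := by positivity
    have hsub : {n | ξ ∈ (freqBall N q (j n))ᶜ} ⊆ {n | b < t n} := by
      intro n hn
      have h1 : q ^ j n < ‖ξ‖ ^ 2 := not_le.1 hn
      have h2 : (2 : ℝ) ^ j n < Y ^ (1 - s) := by
        have h3 : (q ^ j n) ^ (1 - s) < Y ^ (1 - s) :=
          Real.rpow_lt_rpow (by positivity) (by linarith) hs1
        rwa [← Real.rpow_natCast_mul hq0.le, mul_comm, Real.rpow_mul_natCast hq0.le,
          freqRatio_rpow_one_sub hs₁] at h3
      refine lt_trans ?_ (hj n)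
      rw [hb, Real.rpow_neg hY0.le, pow_succ, one_div, inv_pow]
      have : (Y ^ (1 - s))⁻¹ < (2 ^ j n)⁻¹ := inv_strictAnti₀ (by positivity) h2
      linarith
    have hts : ∑' n, ((freqBall N q (j n))ᶜ).indicator (1 : 𝔼 → ℝ≥0∞) ξ
        = (({n | ξ ∈ (freqBall N q (j n))ᶜ}.encard : ℕ∞) : ℝ≥0∞) := by
      rw [← ENNReal.tsum_set_one, tsum_subtype {n | ξ ∈ (freqBall N q (j n))ᶜ} (fun _ => (1 : ℝ≥0∞))]
      rfl
    have hle : ENNReal.ofReal (b ^ r) * (({n : ℕ | b < t n}.encard : ℕ∞) : ℝ≥0∞) ≤ C :=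
      le_iSup (fun b : Set.Ioi (0 : ℝ) =>
        ENNReal.ofReal ((b : ℝ) ^ r) * (({n : ℕ | (b : ℝ) < t n}.encard : ℕ∞) : ℝ≥0∞)) ⟨b, hb0⟩
    have hbr : ENNReal.ofReal (2 ^ r) * ENNReal.ofReal (Y ^ s) * ENNReal.ofReal (b ^ r) = 1 := by
      rw [← ENNReal.ofReal_mul (by positivity), ← ENNReal.ofReal_mul (by positivity), hb,
        Real.div_rpow (by positivity) (by norm_num), ← Real.rpow_mul hY0.le]
      have : -(1 - s) * r = -s := by rw [hr]; field_simp
      rw [this, Real.rpow_neg hY0.le]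
      have := Real.rpow_pos_of_pos hY0 s
      rw [← ENNReal.ofReal_one]
      congr 1
      field_simp
    calc ∑' n, ((freqBall N q (j n))ᶜ).indicator (1 : 𝔼 → ℝ≥0∞) ξ
        ≤ (({n : ℕ | b < t n}.encard : ℕ∞) : ℝ≥0∞) := by
          rw [hts]
          exact_mod_cast Set.encard_le_encard hsub
      _ = ENNReal.ofReal (2 ^ r) * ENNReal.ofReal (Y ^ s) *
          (ENNReal.ofReal (b ^ r) * (({n : ℕ | b < t n}.encard : ℕ∞) : ℝ≥0∞)) := by
          rw [← mul_assoc, hbr, one_mul]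
      _ ≤ ENNReal.ofReal (2 ^ r) * ENNReal.ofReal (Y ^ s) * C := by gcongr
      _ = _ := by ring
  have hmeas : AEMeasurable (fun ξ => ‖(𝓕 f : L2) ξ‖ₑ ^ 2) volume :=
    (Lp.aestronglyMeasurable (𝓕 f : L2)).enorm.pow_const 2
  have h1 : ∀ n, ‖fourierRestrict (measurableSet_freqBall q (j n)).compl f‖ₑ ^ 2
      = ∫⁻ ξ, ((freqBall N q (j n))ᶜ).indicator (1 : 𝔼 → ℝ≥0∞) ξ * ‖(𝓕 f : L2) ξ‖ₑ ^ 2 := by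
    intro n
    rw [enorm_fourierRestrict_sq, ← lintegral_indicator (measurableSet_freqBall q (j n)).compl]
    refine lintegral_congr fun ξ => ?_
    by_cases hξ : ξ ∈ (freqBall N q (j n))ᶜ
    · simp only [Set.indicator_of_mem hξ, Pi.one_apply, one_mul]
    · simp only [Set.indicator_of_notMem hξ, zero_mul]
  simp_rw [h1]
  have hm : ∀ n, AEMeasurable (fun ξ => ((freqBall N q (j n))ᶜ).indicator (1 : 𝔼 → ℝ≥0∞) ξ *
      ‖(𝓕 f : L2) ξ‖ₑ ^ 2) volume := fun n =>
    ((measurable_one.indicator (measurableSet_freqBall q (j n)).compl).aemeasurable).mul hmeas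
  rw [← lintegral_tsum hm]
  simp_rw [ENNReal.tsum_mul_right]
  refine ne_top_of_le_ne_top (b := C * ENNReal.ofReal (2 ^ r) * ‖h‖ₑ ^ 2) ?_ ?_
  · exact ENNReal.mul_ne_top (ENNReal.mul_ne_top hCtop ENNReal.ofReal_ne_top) (by simp)
  · rw [enorm_sq_eq_lintegral h, ← lintegral_const_mul' _ _
      (ENNReal.mul_ne_top hCtop ENNReal.ofReal_ne_top)]
    refine lintegral_mono_ae ?_
    filter_upwards [weight_mul_enorm_sq hf] with ξ hξ
    rw [← hξ, ← mul_assoc]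
    exact mul_le_mul_left (hcount ξ) _

theorem ae_tendsto_of_memWeakEll {s : ℝ} (hs₀ : 0 < s) (hs₁ : s < 1) (ε : Fin N → ℤˣ) {t : ℕ → ℝ}
    (ht_mem : ∀ n, t n ∈ Set.Ioo (0 : ℝ) 1) (ht : Antitone t) (ht_lim : Tendsto t atTop (𝓝 0))
    (hw : MemWeakEll (s / (1 - s)) t) {f : L2} (hf : MemHs s f) :
    ∀ᵐ x, Tendsto (fun n => schrodingerMean (signedSymbol ε) (t n) f x) atTop (𝓝 (f x)) := by
  obtain ⟨h, hfh⟩ := (memHs_iff hs₀.le f).1 hf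
  have hjex : ∀ n, ∃ j : ℕ, (1 / 2 : ℝ) ^ (j + 1) < t n ∧ t n ≤ (1 / 2) ^ j := fun n =>
    exists_nat_pow_near_of_lt_one (ht_mem n).1 (ht_mem n).2.le (by norm_num) (by norm_num)
  choose j hj1 hj2 using hjex
  have hjlim : Tendsto j atTop atTop := by
    refine tendsto_atTop.2 fun J => ?_
    have hpos : (0 : ℝ) < (1 / 2) ^ J := by positivity
    filter_upwards [ht_lim.eventually (Iio_mem_nhds hpos)] with n hn
    by_contra! hlt
    have : (1 / 2 : ℝ) ^ J ≤ (1 / 2) ^ (j n + 1) :=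
      pow_le_pow_of_le_one (by norm_num) (by norm_num) hlt
    exact absurd (hj1 n) (not_lt.2 ((le_of_lt hn).trans this))
  set q := freqRatio s with hq
  -- The cut-off moves with `n`, at the dyadic scale of `t n`.
  set low : ℕ → L2 := fun n => fourierRestrict (measurableSet_freqBall q (j n)) f with hlow
  set high : ℕ → L2 := fun n => fourierRestrict (measurableSet_freqBall q (j n)).compl f with hhigh
  set T : ℕ → L2 → L2 := fun n => schrodingerMean (signedSymbol ε) (t n) with hT
  have hdec : ∀ n, T n f - f = (T n (low n) - low n) + (T n (high n) - high n) := by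
    intro n
    have h1 : f = low n + high n := by
      rw [← fourierRestrict_add _ _ MeasurableSet.univ disjoint_compl_right (by simp) f,
        fourierRestrict_univ]
    conv_lhs => rw [h1]
    rw [hT]
    simp only [schrodingerMean_add]
    abel
  have hhi : ∀ᵐ x, Tendsto (fun n => (T n (high n) - high n) x) atTop (𝓝 0) := by
    have hm : ∀ n, AEMeasurable (fun x => ‖(T n (high n) - high n) x‖ₑ ^ 2) volume := fun n =>
      (Lp.aestronglyMeasurable _).enorm.pow_const 2
    have hfin : ∫⁻ x, ∑' n, ‖(T n (high n) - high n) x‖ₑ ^ 2 ≠ ⊤ := by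
      rw [lintegral_tsum hm]
      have hb : ∀ n, ∫⁻ x, ‖(T n (high n) - high n) x‖ₑ ^ 2 ≤ ENNReal.ofReal 4 * ‖high n‖ₑ ^ 2 := by
        intro n
        rw [← enorm_sq_eq_lintegral, ← ofReal_norm, ← ofReal_norm, ← ENNReal.ofReal_pow (norm_nonneg _),
          ← ENNReal.ofReal_pow (norm_nonneg _), ← ENNReal.ofReal_mul (by norm_num)]
        refine ENNReal.ofReal_le_ofReal ?_
        have h2 : ‖T n (high n) - high n‖ ≤ 2 * ‖high n‖ := by
          refine (norm_sub_le _ _).trans ?_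
          rw [hT]
          simp only [norm_schrodingerMean]
          linarith
        nlinarith [norm_nonneg (T n (high n) - high n)]
      refine ne_top_of_le_ne_top ?_ (ENNReal.tsum_le_tsum hb)
      rw [ENNReal.tsum_mul_left]
      exact ENNReal.mul_ne_top ENNReal.ofReal_ne_top (tsum_high_ne_top hs₀ hs₁ hfh hw hj1)
    filter_upwards [ae_lt_top' (AEMeasurable.tsum hm) hfin] with x hx
    exact tendsto_zero_of_tsum_sq_lt_top hx.ne
  obtain ⟨Z, hZ1, hZ2⟩ := exists_majorant_low hs₀ hs₁ ε ht (fun n => (ht_mem n).1.le) ht_lim hfh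
  have hlo : ∀ᵐ x, Tendsto (fun n => (T n (low n) - low n) x) atTop (𝓝 0) := by
    filter_upwards [hZ1, hZ2] with x h1 h2
    have hz := (ENNReal.tendsto_atTop_zero_of_tsum_ne_top h1).comp hjlim
    have hsq : Tendsto (fun n => ‖(T n (low n) - low n) x‖ₑ ^ 2) atTop (𝓝 0) :=
      tendsto_of_tendsto_of_tendsto_of_le_of_le tendsto_const_nhds hz (fun _ => zero_le)
        (fun n => h2 (j n) n (hj2 n))
    exact tendsto_zero_of_enorm_sq hsq
  have hae : ∀ᵐ x, ∀ n, T n f x = f x + ((T n (low n) - low n) x + (T n (high n) - high n) x) := by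
    refine ae_all_iff.2 fun n => ?_
    have h1 := Lp.coeFn_sub (T n f) f
    rw [hdec n] at h1
    filter_upwards [h1, Lp.coeFn_add (T n (low n) - low n) (T n (high n) - high n)] with x h1 h2
    rw [h2, Pi.add_apply, Pi.sub_apply] at h1
    rw [h1]
    ring
  filter_upwards [hae, hlo, hhi] with x h1 h2 h3
  have : Tendsto (fun n => f x + ((T n (low n) - low n) x + (T n (high n) - high n) x)) atTop
      (𝓝 (f x + (0 + 0))) := tendsto_const_nhds.add (h2.add h3)
  rw [add_zero, add_zero] at this
  exact this.congr fun n => (h1 n).symm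

end Sufficiency

/-! ### Banach's principle. -/

section BanachPrinciple

variable {α E : Type*} [MeasurableSpace α] {μ : Measure α} [NormedAddCommGroup E]
  [NormedSpace ℂ E]

theorem measure_one_le_norm_le (f : Lp ℂ 2 μ) : μ {x | 1 ≤ ‖f x‖} ≤ ‖f‖ₑ ^ 2 := by
  rw [enorm_sq_eq_lintegral]
  have h := mul_meas_ge_le_lintegral₀ (μ := μ)
    ((Lp.aestronglyMeasurable f).enorm.pow_const 2) 1
  rw [one_mul] at h
  refine le_trans (measure_mono fun x hx => ?_) h
  have hx' : 1 ≤ ‖f x‖ := hx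
  have : (1 : ℝ≥0∞) ≤ ‖f x‖ₑ := by
    rw [← ofReal_norm, ← ENNReal.ofReal_one]
    exact ENNReal.ofReal_le_ofReal hx'
  exact one_le_pow₀ this

/-- The maximal function of `A n g` exceeds the level `c` on a set of measure at most `δ`. -/
def MaximalLE (ν : Measure α) (A : ℕ → E →L[ℂ] Lp ℂ 2 μ) (c : ℝ) (δ : ℝ≥0∞) (g : E) : Prop :=
  ν {x | ∃ n, c < ‖A n g x‖} ≤ δ

/-- Raising the level by `1` replaces closedness of the set. For finitely many `n`, Chebyshev's
inequality makes the sets where `A n (g - g')` reaches `1` negligible as `g' → g`; continuity from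
below then removes the restriction on `n`. -/
theorem maximalLE_of_mem_closure {ν : Measure α} (hν : ν ≤ μ) (A : ℕ → E →L[ℂ] Lp ℂ 2 μ) {c : ℝ}
    {δ : ℝ≥0∞} {g : E} (hg : g ∈ closure {g | MaximalLE ν A c δ g}) :
    MaximalLE ν A (c + 1) δ g := by
  have hU : {x | ∃ n, c + 1 < ‖A n g x‖} = ⋃ M : ℕ, {x | ∃ n < M, c + 1 < ‖A n g x‖} := by
    ext x
    simp only [Set.mem_ofPred_eq, Set.mem_iUnion]
    exact ⟨fun ⟨n, hn⟩ => ⟨n + 1, n, n.lt_succ_self, hn⟩, fun ⟨_, n, _, hn⟩ => ⟨n, hn⟩⟩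
  have hmono : Monotone fun M : ℕ => {x | ∃ n < M, c + 1 < ‖A n g x‖} :=
    fun a b hab x ⟨n, hn, h⟩ => ⟨n, hn.trans_le hab, h⟩
  rw [MaximalLE, hU, hmono.measure_iUnion]
  refine iSup_le fun M => ?_
  have hne : (𝓝[{g | MaximalLE ν A c δ g}] g).NeBot := mem_closure_iff_nhdsWithin_neBot.1 hg
  have hlim : Tendsto (fun g' => δ + ∑ n ∈ Finset.range M, ‖A n (g - g')‖ₑ ^ 2)
      (𝓝[{g | MaximalLE ν A c δ g}] g) (𝓝 (δ + ∑ n ∈ Finset.range M, ‖A n (g - g)‖ₑ ^ 2)) := by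
    refine Tendsto.mono_left (Continuous.tendsto ?_ g) nhdsWithin_le_nhds
    refine continuous_const.add (continuous_finsetSum _ fun n _ => ?_)
    exact (ENNReal.continuous_pow 2).comp
      (continuous_enorm.comp ((A n).continuous.comp (continuous_const.sub continuous_id)))
  simp only [sub_self, map_zero, enorm_zero, ne_eq, OfNat.ofNat_ne_zero, not_false_eq_true, zero_pow,
    Finset.sum_const_zero, add_zero] at hlim
  refine ge_of_tendsto hlim ?_
  filter_upwards [self_mem_nhdsWithin] with g' hg'
  have hsub : ∀ᵐ x ∂ν, ∀ n, A n (g - g') x = A n g x - A n g' x := by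
    refine ae_mono hν (ae_all_iff.2 fun n => ?_)
    rw [map_sub]
    exact Lp.coeFn_sub _ _
  have h1 : {x | ∃ n < M, c + 1 < ‖A n g x‖} ≤ᵐ[ν]
      ({x | ∃ n, c < ‖A n g' x‖} ∪ ⋃ n ∈ Finset.range M, {x | 1 ≤ ‖A n (g - g') x‖} : Set α) := by
    filter_upwards [hsub] with x hx hmem
    obtain ⟨n, hn, h⟩ := hmem
    by_cases h' : c < ‖A n g' x‖
    · exact Or.inl ⟨n, h'⟩
    · refine Or.inr (Set.mem_biUnion (Finset.mem_coe.2 (Finset.mem_range.2 hn)) ?_)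
      change 1 ≤ ‖A n (g - g') x‖
      rw [hx]
      have := norm_sub_norm_le (A n g x) (A n g' x)
      linarith
  refine (measure_mono_ae h1).trans ((measure_union_le _ _).trans (add_le_add hg' ?_))
  refine (measure_biUnion_finset_le _ _).trans (Finset.sum_le_sum fun n _ => ?_)
  exact (hν _).trans (measure_one_le_norm_le _)

/-- **Banach's principle**: if the maximal function of a sequence of bounded operators is finite
almost everywhere, then it is continuous in measure at `0` on sets of finite measure. -/
theorem exists_maximalLE_of_ae_bounded [CompleteSpace E] (A : ℕ → E →L[ℂ] Lp ℂ 2 μ)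
    (hA : ∀ g, ∀ᵐ x ∂μ, ∃ C : ℝ, ∀ n, ‖A n g x‖ ≤ C) (B : Set α) (hB : μ B ≠ ⊤) {δ : ℝ≥0∞}
    (hδ : 0 < δ) : ∃ C : ℝ, 0 < C ∧ ∀ g : E, ‖g‖ ≤ 1 → MaximalLE (μ.restrict B) A C δ g := by
  set ν := μ.restrict B with hν
  have hνμ : ν ≤ μ := Measure.restrict_le_self
  have : IsFiniteMeasure ν := ⟨by rw [hν, Measure.restrict_apply_univ]; exact hB.lt_top⟩
  have hδ2 : 0 < δ / 2 := ENNReal.half_pos hδ.ne'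
  have hcover : ⋃ k : ℕ, closure {g | MaximalLE ν A (k : ℝ) (δ / 2) g} = Set.univ := by
    refine Set.eq_univ_of_forall fun g => Set.mem_iUnion.2 ?_
    have hm : ∀ k : ℕ, NullMeasurableSet {x | ∃ n, (k : ℝ) < ‖A n g x‖} ν := by
      intro k
      simp only [Set.ofPred_exists]
      refine NullMeasurableSet.iUnion fun n => ?_
      exact nullMeasurableSet_lt aemeasurable_const
        ((Lp.aestronglyMeasurable (A n g)).mono_measure hνμ).norm.aemeasurable
    have hanti : Antitone fun k : ℕ => {x | ∃ n, (k : ℝ) < ‖A n g x‖} :=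
      fun a b hab x ⟨n, hn⟩ => ⟨n, lt_of_le_of_lt (by exact_mod_cast hab) hn⟩
    have ht := tendsto_measure_iInter_atTop hm hanti ⟨0, measure_ne_top ν _⟩
    have h0 : ν (⋂ k : ℕ, {x | ∃ n, (k : ℝ) < ‖A n g x‖}) = 0 := by
      rw [measure_eq_zero_iff_ae_notMem]
      filter_upwards [ae_mono hνμ (hA g)] with x ⟨C, hC⟩ hx
      obtain ⟨k, hk⟩ := exists_nat_ge C
      obtain ⟨n, hn⟩ := Set.mem_iInter.1 hx k
      linarith [hC n]
    rw [h0] at ht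
    obtain ⟨k, hk⟩ := (ht.eventually (Iic_mem_nhds hδ2)).exists
    exact ⟨k, subset_closure hk⟩
  -- Baire's theorem: the bound holds uniformly on some ball about `g₀`.
  obtain ⟨k, g₀, hg₀⟩ := nonempty_interior_of_iUnion_of_closed (fun _ => isClosed_closure) hcover
  obtain ⟨ρ, hρ, hball⟩ := Metric.isOpen_iff.1 isOpen_interior g₀ hg₀
  have hk : ∀ g ∈ Metric.ball g₀ ρ, MaximalLE ν A (k + 1) (δ / 2) g := fun g hg =>
    maximalLE_of_mem_closure hνμ A (interior_subset (hball hg))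
  -- Subtracting the bounds at `g₀` and at `g₀ + (ρ / 2) • g` gives `(ρ / 2) ‖A n g x‖ ≤ 2 (k + 1)`
  -- off two sets of measure at most `δ / 2` each.
  refine ⟨2 * (k + 1) / (ρ / 2), by positivity, fun g hg => ?_⟩
  have h1 := hk g₀ (Metric.mem_ball_self hρ)
  have h2 := hk (g₀ + ((ρ / 2 : ℝ) : ℂ) • g) (by
    rw [Metric.mem_ball, dist_eq_norm, add_sub_cancel_left, norm_smul, Complex.norm_real,
      Real.norm_eq_abs, abs_of_pos (by positivity)]
    nlinarith)
  have hlin : ∀ᵐ x ∂ν, ∀ n, A n (g₀ + ((ρ / 2 : ℝ) : ℂ) • g) x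
      = A n g₀ x + ((ρ / 2 : ℝ) : ℂ) * A n g x := by
    refine ae_mono hνμ (ae_all_iff.2 fun n => ?_)
    rw [map_add, map_smul]
    filter_upwards [Lp.coeFn_add (A n g₀) (((ρ / 2 : ℝ) : ℂ) • A n g),
      Lp.coeFn_smul ((ρ / 2 : ℝ) : ℂ) (A n g)] with x e1 e2
    rw [e1, Pi.add_apply, e2, Pi.smul_apply, smul_eq_mul]
  have hsub : {x | ∃ n, 2 * (k + 1) / (ρ / 2) < ‖A n g x‖} ≤ᵐ[ν]
      ({x | ∃ n, (k + 1 : ℝ) < ‖A n g₀ x‖} ∪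
        {x | ∃ n, (k + 1 : ℝ) < ‖A n (g₀ + ((ρ / 2 : ℝ) : ℂ) • g) x‖} : Set α) := by
    filter_upwards [hlin] with x hx ⟨n, hn⟩
    by_contra hcon
    have e1 : ‖A n g₀ x‖ ≤ k + 1 := not_lt.1 fun h => hcon (Or.inl ⟨n, h⟩)
    have e2 : ‖A n (g₀ + ((ρ / 2 : ℝ) : ℂ) • g) x‖ ≤ k + 1 := not_lt.1 fun h => hcon (Or.inr ⟨n, h⟩)
    rw [hx] at e2
    have e3 : ‖((ρ / 2 : ℝ) : ℂ) * A n g x‖ ≤ 2 * (k + 1) := by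
      have := norm_sub_le (A n g₀ x + ((ρ / 2 : ℝ) : ℂ) * A n g x) (A n g₀ x)
      rw [add_sub_cancel_left] at this
      linarith
    rw [norm_mul, Complex.norm_real, Real.norm_eq_abs, abs_of_pos (by positivity)] at e3
    rw [div_lt_iff₀ (by positivity)] at hn
    linarith
  refine (measure_mono_ae hsub).trans ((measure_union_le _ _).trans ?_)
  exact (add_le_add h1 h2).trans (ENNReal.add_halves δ).le

end BanachPrinciple

/-! ### Distribution of the times outside weak `ℓ^r`. -/

section Sequences

variable {t : ℕ → ℝ}

theorem finite_setOf_lt (ht_lim : Tendsto t atTop (𝓝 0)) {b : ℝ} (hb : 0 < b) :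
    {n | b < t n}.Finite := by
  have h := ht_lim.eventually (Iic_mem_nhds hb)
  rw [← Nat.cofinite_eq_atTop] at h
  refine (Filter.eventually_cofinite.1 h).subset fun n hn => ?_
  exact not_le.2 hn

theorem memWeakEll_of_forall_ncard_le (ht_lim : Tendsto t atTop (𝓝 0)) {r D : ℝ}
    (h : ∀ b, 0 < b → b ^ r * {n | b < t n}.ncard ≤ D) : MemWeakEll r t := by
  refine lt_of_le_of_lt (iSup_le fun b => ?_) (ENNReal.ofReal_lt_top (r := D))
  have hb : 0 < (b : ℝ) := b.2
  rw [← (finite_setOf_lt ht_lim hb).cast_ncard_eq]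
  refine le_trans (le_of_eq ?_) (ENNReal.ofReal_le_ofReal (h b hb))
  rw [ENNReal.ofReal_mul (by positivity), ENNReal.ofReal_natCast]
  simp

/-- A sequence outside the weak space has dyadic windows with arbitrarily many terms. -/
theorem exists_large_window (ht_lt : ∀ n, t n < 1) (ht_lim : Tendsto t atTop (𝓝 0)) {r : ℝ}
    (hr : 0 < r) (hw : ¬ MemWeakEll r t) (A : ℝ) {η : ℝ} (hη : 0 < η) :
    ∃ b, 0 < b ∧ b < η ∧ A * b ^ (-r) ≤ {n | b < t n ∧ t n ≤ 2 * b}.ncard := by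
  by_contra! hcon
  apply hw
  have h2r : (2 : ℝ) ^ (-r) < 1 := Real.rpow_lt_one_of_one_lt_of_neg one_lt_two (by linarith)
  -- The second entry is the fixed point of `D = 2 ^ (-r) * D + A`, the recursion obtained on
  -- halving `b`; the first starts the induction at levels at least `η`.
  set D := max ({n | η < t n}.ncard : ℝ) (A / (1 - 2 ^ (-r))) with hD
  have hD0 : 0 ≤ D := le_max_of_le_left (Nat.cast_nonneg _)
  have hbase : ∀ b, η ≤ b → b ^ r * {n | b < t n}.ncard ≤ D := by
    intro b hb
    have hb0 : 0 < b := hη.trans_le hb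
    rcases le_or_gt 1 b with h1 | h1
    · have : {n | b < t n} = ∅ := Set.eq_empty_of_forall_notMem fun n hn =>
        absurd (ht_lt n) (not_lt.2 (h1.trans (le_of_lt hn)))
      simp [this, hD0]
    · have hle : ({n | b < t n}.ncard : ℝ) ≤ {n | η < t n}.ncard := by
        exact_mod_cast Set.ncard_le_ncard (fun n hn => lt_of_le_of_lt hb hn)
          (finite_setOf_lt ht_lim hη)
      have : b ^ r ≤ 1 := Real.rpow_le_one hb0.le h1.le hr.le
      calc b ^ r * {n | b < t n}.ncard ≤ 1 * {n | η < t n}.ncard := by gcongr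
        _ ≤ D := by rw [one_mul]; exact le_max_left _ _
  have hind : ∀ m : ℕ, ∀ b, η / 2 ^ m ≤ b → b ^ r * {n | b < t n}.ncard ≤ D := by
    intro m
    induction m with
    | zero => intro b hb; exact hbase b (by simpa using hb)
    | succ m ih =>
      intro b hb
      have hb0 : 0 < b := lt_of_lt_of_le (by positivity) hb
      rcases le_or_gt η b with h1 | h1
      · exact hbase b h1
      have hunion : {n | b < t n} ⊆ {n | 2 * b < t n} ∪ {n | b < t n ∧ t n ≤ 2 * b} := by
        intro n hn
        rcases lt_or_ge (2 * b) (t n) with h | h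
        · exact Or.inl h
        · exact Or.inr ⟨hn, h⟩
      have hcard : ({n | b < t n}.ncard : ℝ)
          ≤ {n | 2 * b < t n}.ncard + {n | b < t n ∧ t n ≤ 2 * b}.ncard := by
        have hfin : ({n | 2 * b < t n} ∪ {n | b < t n ∧ t n ≤ 2 * b}).Finite :=
          (finite_setOf_lt ht_lim (by linarith)).union
            ((finite_setOf_lt ht_lim hb0).subset fun n hn => hn.1)
        exact_mod_cast (Set.ncard_le_ncard hunion hfin).trans (Set.ncard_union_le _ _)
      have h2 := ih (2 * b) (by rw [pow_succ] at hb; field_simp at hb ⊢; linarith)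
      have h3 := (hcon b hb0 h1).le
      have hbr : 0 < b ^ r := Real.rpow_pos_of_pos hb0 r
      have h4 : b ^ r * {n | b < t n ∧ t n ≤ 2 * b}.ncard ≤ A := by
        calc b ^ r * {n | b < t n ∧ t n ≤ 2 * b}.ncard ≤ b ^ r * (A * b ^ (-r)) := by gcongr
          _ = A := by rw [Real.rpow_neg hb0.le]; field_simp
      have h5 : b ^ r * {n | 2 * b < t n}.ncard ≤ 2 ^ (-r) * D := by
        have : b ^ r = 2 ^ (-r) * (2 * b) ^ r := by
          rw [Real.mul_rpow two_pos.le hb0.le, ← mul_assoc, ← Real.rpow_add two_pos]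
          simp
        rw [this, mul_assoc]
        gcongr
      have h6 : A ≤ (1 - 2 ^ (-r)) * D := by
        have : A / (1 - 2 ^ (-r)) ≤ D := le_max_right _ _
        rw [div_le_iff₀ (by linarith)] at this
        linarith
      calc b ^ r * {n | b < t n}.ncard
          ≤ b ^ r * ({n | 2 * b < t n}.ncard + {n | b < t n ∧ t n ≤ 2 * b}.ncard) := by gcongr
        _ ≤ D := by rw [mul_add]; linarith
  refine memWeakEll_of_forall_ncard_le ht_lim (D := D) fun b hb => ?_
  obtain ⟨m, hm⟩ := pow_unbounded_of_one_lt (η / b) (one_lt_two (α := ℝ))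
  refine hind m b ?_
  rw [div_lt_iff₀ hb] at hm
  rw [div_le_iff₀ (by positivity)]
  linarith

/-- By monotonicity of the gaps, a window with many terms forces all smaller terms to be dense. -/
theorem exists_phase_near_int (ht_anti : Antitone t)
    (ht_lim : Tendsto t atTop (𝓝 0)) (ht_gap : Antitone fun n => t n - t (n + 1)) {b : ℝ} (hb : 0 < b)
    {L : ℕ} (hL : 1 ≤ L) (hcard : L + 2 ≤ {n | b < t n ∧ t n ≤ 2 * b}.ncard) (y : ℝ) :
    ∃ n, t n ≤ b ∧ ∃ m : ℤ, |y + t n / b - m| ≤ 1 / L := by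
  classical
  have hex : ∀ c : ℝ, 0 < c → ∃ n, t n ≤ c := fun c hc =>
    (ht_lim.eventually (Iic_mem_nhds hc)).exists
  set p := Nat.find (hex b hb) with hp
  set p' := Nat.find (hex (2 * b) (by linarith)) with hp'
  have hpt : t p ≤ b := Nat.find_spec (hex b hb)
  have hpt' : t p' ≤ 2 * b := Nat.find_spec (hex (2 * b) (by linarith))
  have hplt : ∀ n, n < p → b < t n := fun n hn => not_le.1 (Nat.find_min (hex b hb) hn)
  have hcard' : L + 2 ≤ p - p' := by
    refine hcard.trans ?_
    have hsub : {n | b < t n ∧ t n ≤ 2 * b} ⊆ (Finset.Ico p' p : Set ℕ) := by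
      rintro n ⟨h1, h2⟩
      rw [Finset.coe_Ico, Set.mem_Ico]
      refine ⟨Nat.find_min' _ h2, ?_⟩
      by_contra! h
      exact absurd (ht_anti h) (not_le.2 (hpt.trans_lt h1))
    have := Set.ncard_le_ncard hsub (Finset.finite_toSet _)
    rwa [Set.ncard_coe_finset, Nat.card_Ico] at this
  have hL0 : (0 : ℝ) < L := by exact_mod_cast hL
  -- The `L` gaps from index `p'` on lie inside a window of length `b` and are at least as large as
  -- the gap at `n`. The index `p - 1` is included because that step crosses `b`.
  have hgap : ∀ n, p - 1 ≤ n → t n - t (n + 1) ≤ b / L := by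
    intro n hn
    have h1 : (L : ℝ) * (t n - t (n + 1)) ≤ t p' - t (p' + L) := by
      have h2 := Finset.sum_range_sub' (fun i => t (p' + i)) L
      simp only [add_zero] at h2
      have h3 : ∑ i ∈ Finset.range L, (t n - t (n + 1))
          ≤ ∑ i ∈ Finset.range L, (t (p' + i) - t (p' + (i + 1))) := by
        refine Finset.sum_le_sum fun i hi => ht_gap ?_
        have := Finset.mem_range.1 hi
        omega
      rw [h2, Finset.sum_const, Finset.card_range, nsmul_eq_mul] at h3
      exact h3
    have h4 : b < t (p' + L) := hplt _ (by omega)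
    rw [le_div_iff₀ hL0]
    linarith
  -- `y + z` is the integer `⌊y⌋ + 1`; the first time at most `b * z` undershoots it by at most one
  -- gap.
  set z := 1 - Int.fract y with hz
  have hz0 : 0 < z := by have := Int.fract_lt_one y; linarith
  have hz1 : z ≤ 1 := by have := Int.fract_nonneg y; linarith
  have hbz : 0 < b * z := by positivity
  set n := Nat.find (hex (b * z) hbz) with hn
  have hnt : t n ≤ b * z := Nat.find_spec (hex (b * z) hbz)
  have hnb : t n ≤ b := hnt.trans (by nlinarith)
  have hpn : p ≤ n := Nat.find_min' _ hnb
  have hn1 : b * z < t (n - 1) := not_le.1 (Nat.find_min (hex (b * z) hbz) (by omega))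
  have hg := hgap (n - 1) (by omega)
  rw [Nat.sub_add_cancel (by omega)] at hg
  refine ⟨n, hnb, ⌊y⌋ + 1, ?_⟩
  have hy : y = ⌊y⌋ + Int.fract y := (Int.floor_add_fract y).symm
  have e1 : t n / b ≤ z := by rw [div_le_iff₀ hb]; linarith
  have e2 : z - 1 / L ≤ t n / b := by
    rw [le_div_iff₀ hb]
    have : (z - 1 / L) * b = b * z - b / L := by ring
    linarith
  push_cast
  rw [abs_le]
  constructor <;> linarith

/-- Take `K` close to `A * b ^ (-r)`. Then `(K / b) ^ s / K` is at most `A ^ (-(1 - s))`, small for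
large `A`. With `A` fixed, `K * b` is of order `A * b ^ (1 - r)`, small for small `b` because `s <
1/2` gives `r < 1`. -/
theorem exists_counterexample_params (ht_lt : ∀ n, t n < 1) (ht_lim : Tendsto t atTop (𝓝 0)) {s : ℝ}
    (hs₀ : 0 < s) (hs₁ : s < 1 / 2) (hw : ¬ MemWeakEll (s / (1 - s)) t) {κ η : ℝ} (hκ : 0 < κ)
    (hη : 0 < η) : ∃ (b : ℝ) (K : ℕ), 0 < b ∧ b ≤ 1 ∧ 1 ≤ K ∧ K * b ≤ κ ∧
      (K / b) ^ s / K ≤ η ∧ 16 * K + 2 ≤ {n | b < t n ∧ t n ≤ 2 * b}.ncard := by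
  have hs1 : 0 < 1 - s := by linarith
  set r := s / (1 - s) with hr
  have hr0 : 0 < r := by positivity
  have hr1 : r < 1 := by rw [hr, div_lt_one hs1]; linarith
  obtain ⟨A, hA1, hAη⟩ : ∃ A : ℝ, 1 ≤ A ∧ A ^ (-(1 - s)) ≤ η := by
    have h := (tendsto_rpow_neg_atTop hs1).eventually (Iic_mem_nhds hη)
    obtain ⟨A, h1, h2⟩ := ((eventually_ge_atTop (1 : ℝ)).and h).exists
    exact ⟨A, h1, h2⟩
  have hA0 : 0 < A := by linarith
  obtain ⟨η', hη'0, hη'⟩ : ∃ η' > 0, ∀ b, 0 < b → b < η' → 2 * A * b ^ (1 - r) ≤ κ := by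
    have hc : Tendsto (fun b : ℝ => 2 * A * b ^ (1 - r)) (𝓝 0) (𝓝 (2 * A * 0 ^ (1 - r))) :=
      ((Real.continuousAt_rpow_const 0 (1 - r) (Or.inr (by linarith))).tendsto).const_mul _
    rw [Real.zero_rpow (by linarith), mul_zero] at hc
    obtain ⟨η', h0, h1⟩ := Metric.eventually_nhds_iff.1 (hc.eventually (Iic_mem_nhds hκ))
    refine ⟨η', h0, fun b hb hlt => h1 ?_⟩
    rwa [Real.dist_eq, sub_zero, abs_of_pos hb]
  -- The factor `64` leaves room for `16 * K + 2`, since `K ≤ 2 * a` and `a ≥ 1` below.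
  obtain ⟨b, hb0, hbη, hcard⟩ := exists_large_window ht_lt ht_lim hr0 hw (64 * A)
    (lt_min hη'0 one_pos)
  have hb1 : b < 1 := hbη.trans_le (min_le_right _ _)
  set a := A * b ^ (-r) with ha
  have ha1 : 1 ≤ a := by
    have : 1 ≤ b ^ (-r) := Real.one_le_rpow_of_pos_of_le_one_of_nonpos hb0 hb1.le (by linarith)
    nlinarith
  have hKa : a ≤ ⌈a⌉₊ := Nat.le_ceil a
  have hKa2 : (⌈a⌉₊ : ℝ) ≤ 2 * a := by
    have := Nat.ceil_lt_add_one (by linarith : 0 ≤ a)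
    linarith
  have hK0 : (0 : ℝ) < ⌈a⌉₊ := by linarith
  refine ⟨b, ⌈a⌉₊, hb0, hb1.le, Nat.one_le_ceil_iff.2 (by linarith), ?_, ?_, ?_⟩
  · calc (⌈a⌉₊ : ℝ) * b ≤ 2 * a * b := by gcongr
      _ = 2 * A * b ^ (1 - r) := by
        rw [ha, show (1 : ℝ) - r = -r + 1 by ring, Real.rpow_add hb0, Real.rpow_one]
        ring
      _ ≤ κ := hη' b hb0 (hbη.trans_le (min_le_left _ _))
  · have e1 : ((⌈a⌉₊ : ℝ) / b) ^ s / ⌈a⌉₊ = (⌈a⌉₊ : ℝ) ^ (-(1 - s)) * b ^ (-s) := by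
      rw [Real.div_rpow hK0.le hb0.le, show -(1 - s) = s + -1 by ring, Real.rpow_add hK0,
        Real.rpow_neg_one, Real.rpow_neg hb0.le]
      field_simp
    rw [e1]
    calc (⌈a⌉₊ : ℝ) ^ (-(1 - s)) * b ^ (-s) ≤ a ^ (-(1 - s)) * b ^ (-s) := by
          gcongr ?_ * _
          exact Real.rpow_le_rpow_of_nonpos (by linarith) hKa (by linarith)
      _ = A ^ (-(1 - s)) := by
          rw [ha, Real.mul_rpow hA0.le (by positivity), ← Real.rpow_mul hb0.le, mul_assoc,
            ← Real.rpow_add hb0]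
          have : -r * -(1 - s) + -s = 0 := by rw [hr]; field_simp; ring
          rw [this, Real.rpow_zero, mul_one]
      _ ≤ η := hAη
  · have : (16 * ⌈a⌉₊ + 2 : ℝ) ≤ {n | b < t n ∧ t n ≤ 2 * b}.ncard := by
      refine le_trans ?_ hcard
      rw [mul_assoc]
      linarith
    exact_mod_cast this

end Sequences

/-! ### The Bessel potential operator. -/

section Multiplier

variable {N : ℕ}

local notation "𝔼" => EuclideanSpace ℝ (Fin N)
local notation "L2" => Lp ℂ 2 (volume : Measure (EuclideanSpace ℝ (Fin N)))

theorem memLp_top_besselWeight {s : ℝ} (hs : 0 ≤ s) :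
    MemLp (fun ξ : 𝔼 => (((1 + ‖ξ‖ ^ 2) ^ (-s / 2) : ℝ) : ℂ)) ⊤ volume := by
  have hc : Continuous (fun ξ : 𝔼 => (((1 + ‖ξ‖ ^ 2) ^ (-s / 2) : ℝ) : ℂ)) :=
    Complex.continuous_ofReal.comp
      (Continuous.rpow_const (by fun_prop) fun ξ => Or.inl (by positivity))
  refine memLp_top_of_bound hc.aestronglyMeasurable 1 (Eventually.of_forall fun ξ => ?_)
  rw [Complex.norm_real, Real.norm_eq_abs, abs_of_nonneg (by positivity)]
  exact Real.rpow_le_one_of_one_le_of_nonpos (by nlinarith [sq_nonneg ‖ξ‖]) (by linarith)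

/-- The Bessel potential of order `s` as an operator on `L²`; its range is `H^s`. -/
noncomputable def besselOp {s : ℝ} (hs : 0 ≤ s) : L2 →L[ℂ] L2 :=
  ((Lp.fourierTransformₗᵢ 𝔼 ℂ).symm.toContinuousLinearEquiv : L2 →L[ℂ] L2).comp
    ((ContinuousLinearMap.mul ℂ ℂ).holderL volume ⊤ 2 2
      ((memLp_top_besselWeight (N := N) hs).toLp _))

theorem fourier_besselOp {s : ℝ} (hs : 0 ≤ s) (h : L2) :
    ((𝓕 (besselOp hs h) : L2) : 𝔼 → ℂ) =ᵐ[volume]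
      fun ξ => (((1 + ‖ξ‖ ^ 2) ^ (-s / 2) : ℝ) : ℂ) * h ξ := by
  have h1 : (𝓕 (besselOp hs h) : L2) = (ContinuousLinearMap.mul ℂ ℂ).holder 2
      ((memLp_top_besselWeight (N := N) hs).toLp _) h :=
    (Lp.fourierTransformₗᵢ 𝔼 ℂ).apply_symm_apply _
  rw [h1]
  filter_upwards [(ContinuousLinearMap.mul ℂ ℂ).coeFn_holder (r := 2)
    ((memLp_top_besselWeight (N := N) hs).toLp _) h, (memLp_top_besselWeight (N := N) hs).coeFn_toLp]
    with ξ e1 e2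
  rw [e1, e2, ContinuousLinearMap.mul_apply']

theorem memHs_besselOp {s : ℝ} (hs : 0 ≤ s) (h : L2) : MemHs s (besselOp hs h) :=
  (memHs_iff hs _).2 ⟨h, fourier_besselOp hs h⟩

end Multiplier

/-! ### Algebra of the symbol along a null direction. -/

section Symbol

variable {N : ℕ}

local notation "𝔼" => EuclideanSpace ℝ (Fin N)

/-- The reflection `v ↦ (ε i * v i)`. -/
noncomputable def signFlip (ε : Fin N → ℤˣ) (v : 𝔼) : 𝔼 :=
  WithLp.toLp 2 fun i => (((ε i : ℤˣ) : ℤ) : ℝ) * v i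

theorem norm_signFlip (ε : Fin N → ℤˣ) (v : 𝔼) : ‖signFlip ε v‖ = ‖v‖ := by
  rw [EuclideanSpace.norm_eq, EuclideanSpace.norm_eq]
  congr 1
  refine Finset.sum_congr rfl fun i _ => ?_
  rcases Int.units_eq_one_or (ε i) with h | h <;> simp [signFlip, h]

theorem signedSymbol_apply (ε : Fin N → ℤˣ) (v : 𝔼) :
    signedSymbol ε v = ∑ i, (((ε i : ℤˣ) : ℤ) : ℝ) * v i ^ 2 := rfl

theorem signedSymbol_smul (ε : Fin N → ℤˣ) (c : ℝ) (v : 𝔼) :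
    signedSymbol ε (c • v) = c ^ 2 * signedSymbol ε v := by
  simp only [signedSymbol_apply, PiLp.smul_apply, smul_eq_mul, Finset.mul_sum]
  exact Finset.sum_congr rfl fun i _ => by ring

theorem signedSymbol_add (ε : Fin N → ℤˣ) (u v : 𝔼) :
    signedSymbol ε (u + v) = signedSymbol ε u + 2 * inner ℝ (signFlip ε u) v + signedSymbol ε v := by
  simp only [signedSymbol_apply, PiLp.add_apply, PiLp.inner_apply, signFlip, Finset.mul_sum,
    ← Finset.sum_add_distrib]
  refine Finset.sum_congr rfl fun i _ => ?_
  simp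
  ring

theorem abs_signedSymbol_add_sub_le (ε : Fin N → ℤˣ) (u v : 𝔼) :
    |signedSymbol ε (u + v) - signedSymbol ε u| ≤ 2 * (‖u‖ * ‖v‖) + ‖v‖ ^ 2 := by
  rw [signedSymbol_add, show ∀ a b c : ℝ, a + 2 * b + c - a = 2 * b + c from fun a b c => by ring]
  refine (abs_add_le _ _).trans (add_le_add ?_ (abs_signedSymbol_le ε v))
  rw [abs_mul, abs_two]
  gcongr
  exact (abs_real_inner_le_norm _ _).trans (by rw [norm_signFlip])

/-- The vector with coordinates `a + c`, `a - c` in the directions `i`, `j`. -/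
noncomputable def nullFreq (i j : Fin N) (a c : ℝ) : 𝔼 :=
  EuclideanSpace.single i (a + c) + EuclideanSpace.single j (a - c)

theorem signedSymbol_single (ε : Fin N → ℤˣ) (i : Fin N) (a : ℝ) :
    signedSymbol ε (EuclideanSpace.single i a) = (((ε i : ℤˣ) : ℤ) : ℝ) * a ^ 2 := by
  rw [signedSymbol_apply, Finset.sum_eq_single i]
  · simp
  · intro k _ hk
    simp [hk]
  · simp

/-- The opposite signs cancel the squares. For fixed `c` the symbol is linear in `a`, so it shifts
the variable `x i + x j` dual to `a`; this is where nonellipticity enters. -/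
theorem signedSymbol_nullFreq (ε : Fin N → ℤˣ) {i j : Fin N} (hi : ε i = 1) (hj : ε j = -1) (a c : ℝ) :
    signedSymbol ε (nullFreq i j a c) = 4 * a * c := by
  have hij : i ≠ j := fun h => by rw [h, hj] at hi; exact absurd hi (by decide)
  have h0 : inner ℝ (signFlip ε (EuclideanSpace.single i (a + c))) (EuclideanSpace.single j (a - c))
      = 0 := by
    rw [EuclideanSpace.inner_single_right]
    simp [signFlip, hij.symm]
  rw [nullFreq, signedSymbol_add, h0, signedSymbol_single, signedSymbol_single, hi, hj]
  push_cast
  ring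

theorem inner_nullFreq (i j : Fin N) (a c : ℝ) (x : 𝔼) :
    inner ℝ (nullFreq i j a c) x = a * (x i + x j) + c * (x i - x j) := by
  rw [nullFreq, inner_add_left, EuclideanSpace.inner_single_left, EuclideanSpace.inner_single_left]
  simp
  ring

theorem norm_nullFreq_le (i j : Fin N) {a c : ℝ} (ha : 0 ≤ a) (hac : a ≤ c) :
    ‖nullFreq i j a c‖ ≤ 2 * c := by
  refine (norm_add_le _ _).trans ?_
  rw [PiLp.norm_single, PiLp.norm_single, Real.norm_eq_abs, Real.norm_eq_abs,
    abs_of_nonneg (by linarith), abs_of_nonpos (by linarith)]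
  linarith

theorem le_norm_nullFreq_sub {i j : Fin N} (hij : i ≠ j) (a a' c : ℝ) :
    |a - a'| ≤ ‖nullFreq i j a c - nullFreq i j a' c‖ := by
  have h := PiLp.norm_apply_le (nullFreq i j a c - nullFreq i j a' c) i
  refine le_trans (le_of_eq ?_) h
  rw [Real.norm_eq_abs]
  congr 1
  simp [nullFreq, hij]

end Symbol

/-! ### Comparing phases modulo `2π`. -/

section Oscillation

theorem norm_exp_sub_exp_le (a c : ℝ) (m : ℤ) :
    ‖Complex.exp (Complex.I * (a : ℝ)) - Complex.exp (Complex.I * (c : ℝ))‖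
      ≤ |a - c - 2 * Real.pi * m| := by
  have h : Complex.exp (Complex.I * (a : ℝ)) - Complex.exp (Complex.I * (c : ℝ))
      = Complex.exp (Complex.I * (c : ℝ)) *
        (Complex.exp (Complex.I * ((a - c - 2 * Real.pi * m : ℝ) : ℂ)) - 1) := by
    rw [mul_sub, ← Complex.exp_add, mul_one]
    congr 1
    rw [Complex.exp_eq_exp_iff_exists_int]
    refine ⟨m, ?_⟩
    push_cast
    ring
  have h1 : ‖Complex.exp (Complex.I * (c : ℝ))‖ = 1 := by
    rw [mul_comm]; exact Complex.norm_exp_ofReal_mul_I c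
  rw [h, norm_mul, h1, one_mul]
  exact Real.norm_exp_I_mul_ofReal_sub_one_le

theorem le_norm_setIntegral_of_near {E : Type*} [MeasurableSpace E] {μ : Measure E} {U : Set E}
    (hUf : μ U ≠ ⊤) {ψ : E → ℂ} (hψ : IntegrableOn ψ U μ) {c : ℂ}
    (hc : ‖c‖ = 1) (h : ∀ ξ ∈ U, ‖ψ ξ - c‖ ≤ 3 / 4) :
    μ.real U / 4 ≤ ‖∫ ξ in U, ψ ξ ∂μ‖ := by
  have h1 : ∫ ξ in U, (ψ ξ - c) ∂μ = ∫ ξ in U, ψ ξ ∂μ - μ.real U • c := by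
    rw [integral_sub hψ (integrableOn_const hUf), setIntegral_const]
  have h2 : ‖∫ ξ in U, (ψ ξ - c) ∂μ‖ ≤ 3 / 4 * μ.real U :=
    norm_setIntegral_le_of_norm_le_const hUf.lt_top h
  rw [h1] at h2
  have h3 := norm_sub_norm_le (μ.real U • c) (∫ ξ in U, ψ ξ ∂μ)
  rw [norm_sub_rev, norm_smul, hc, mul_one, Real.norm_eq_abs, abs_of_nonneg measureReal_nonneg] at h3
  linarith

end Oscillation

/-! ### Convergence implies weak `ℓ^r`. -/

section Necessity

variable {N : ℕ}

local notation "𝔼" => EuclideanSpace ℝ (Fin N)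
local notation "L2" => Lp ℂ 2 (volume : Measure (EuclideanSpace ℝ (Fin N)))

theorem memLp_indicator_of_bound {E : Type*} [MeasurableSpace E] {μ : Measure E} {U : Set E}
    (hU : MeasurableSet U) (hUf : μ U ≠ ⊤) {F : E → ℂ} (hF : AEStronglyMeasurable F μ) {C : ℝ}
    (hC : ∀ ξ ∈ U, ‖F ξ‖ ≤ C) (p : ℝ≥0∞) : MemLp (U.indicator F) p μ := by
  have : IsFiniteMeasure (μ.restrict U) := ⟨by rw [Measure.restrict_apply_univ]; exact hUf.lt_top⟩
  rw [memLp_indicator_iff_restrict hU]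
  exact MemLp.of_bound hF.restrict C (ae_restrict_of_forall_mem hU hC)

theorem norm_sq_toLp_indicator_le {E : Type*} [MeasurableSpace E] {μ : Measure E} {U : Set E}
    (hU : MeasurableSet U) (hUf : μ U ≠ ⊤) {F : E → ℂ} {C : ℝ} (hC0 : 0 ≤ C)
    (hC : ∀ ξ ∈ U, ‖F ξ‖ ≤ C) (hm : MemLp (U.indicator F) 2 μ) :
    ‖hm.toLp (U.indicator F)‖ ^ 2 ≤ C ^ 2 * μ.real U := by
  have h : ‖hm.toLp (U.indicator F)‖ₑ ^ 2 ≤ ENNReal.ofReal (C ^ 2) * μ U := by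
    rw [enorm_sq_eq_lintegral, ← lintegral_indicator_const hU]
    refine lintegral_mono_ae ?_
    filter_upwards [hm.coeFn_toLp] with ξ hξ
    rw [hξ]
    by_cases h : ξ ∈ U
    · rw [Set.indicator_of_mem h, Set.indicator_of_mem h, ENNReal.ofReal_pow hC0, ← ofReal_norm]
      gcongr
      exact hC ξ h
    · simp [Set.indicator_of_notMem h]
  rw [← ofReal_norm, ← ENNReal.ofReal_pow (norm_nonneg _), ← ENNReal.ofReal_toReal hUf,
    ← ENNReal.ofReal_mul (by positivity)] at h
  exact (ENNReal.ofReal_le_ofReal_iff (by positivity)).1 h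

/-- The factor `(1 + ‖ξ‖²) ^ (s / 2)` in `g` cancels the Bessel weight; what remains is bounded with
support of finite measure, so the inversion integral is classical. -/
theorem ae_schrodingerMean_besselOp_eq (P : C(𝔼, ℝ)) {s : ℝ} (hs : 0 ≤ s) (τ : ℝ) {U : Set 𝔼}
    (hU : MeasurableSet U) (hUf : volume U ≠ ⊤) (a : ℝ) {g : L2}
    (hg : (g : 𝔼 → ℂ) =ᵐ[volume] U.indicator fun ξ => (((1 + ‖ξ‖ ^ 2) ^ (s / 2) * a : ℝ) : ℂ)) :
    ∀ᵐ x : 𝔼, schrodingerMean P τ (besselOp hs g) x = (a : ℂ) * ∫ ξ in U,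
      Complex.exp (Complex.I *
        ((2 * Real.pi * inner ℝ ξ x + τ * P ((2 * Real.pi) • ξ) : ℝ) : ℂ)) := by
  set m : 𝔼 → ℂ := schrodingerMultiplier P τ with hm
  have hmc : Continuous m := by
    have := P.continuous
    simp only [hm]
    unfold schrodingerMultiplier
    fun_prop
  have hHb : ∀ ξ ∈ U, ‖(a : ℂ) * m ξ‖ ≤ |a| := by
    intro ξ _
    rw [norm_mul, hm, norm_schrodingerMultiplier, Complex.norm_real, mul_one, Real.norm_eq_abs]
  have hH : ∀ p, MemLp (U.indicator fun ξ => (a : ℂ) * m ξ) p volume := fun p =>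
    memLp_indicator_of_bound hU hUf (hmc.const_mul _).aestronglyMeasurable hHb p
  have heq : schrodingerMean P τ (besselOp hs g) = 𝓕⁻ ((hH 2).toLp _) := by
    apply fourier_injective
    rw [FourierTransform.fourier_fourierInv_eq]
    apply Lp.ext
    filter_upwards [fourier_schrodingerMean P τ (besselOp hs g), fourier_besselOp hs g, hg,
      (hH 2).coeFn_toLp] with ξ h1 h2 h3 h4
    rw [h1, h2, h3, h4]
    by_cases hξ : ξ ∈ U
    · rw [Set.indicator_of_mem hξ, Set.indicator_of_mem hξ]
      have hpos : 0 < 1 + ‖ξ‖ ^ 2 := by positivity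
      have h5 : (1 + ‖ξ‖ ^ 2) ^ (-s / 2) * ((1 + ‖ξ‖ ^ 2) ^ (s / 2) * a) = a := by
        rw [← mul_assoc, ← Real.rpow_add hpos]
        simp [neg_div]
      rw [← Complex.ofReal_mul, h5, mul_comm]
    · rw [Set.indicator_of_notMem hξ, Set.indicator_of_notMem hξ, mul_zero, mul_zero]
  rw [heq]
  filter_upwards [coeFn_fourierInv_toLp (hH 2) (memLp_one_iff_integrable.1 (hH 1))] with x hx
  rw [hx, Real.fourierInv_eq', ← integral_const_mul, ← integral_indicator hU]
  refine integral_congr_ae (Eventually.of_forall fun ξ => ?_)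
  by_cases hξ : ξ ∈ U
  · simp only [Set.indicator_of_mem hξ, smul_eq_mul, hm, schrodingerMultiplier]
    rw [mul_left_comm, ← Complex.exp_add]
    congr 2
    push_cast
    ring
  · simp only [Set.indicator_of_notMem hξ, smul_zero]

set_option maxHeartbeats 1000000 in
/-- Data concentrated at frequencies near `(1, 1)`-multiples, for which the symbol acts by
translation, focus at every point of a fixed ball at one of the times `t n ≤ b`. -/
theorem exists_focusing_data (ε : Fin N → ℤˣ) {i j : Fin N} (hi : ε i = 1) (hj : ε j = -1) {s : ℝ}
    (hs₀ : 0 ≤ s) (hs₁ : s ≤ 1) {t : ℕ → ℝ} (ht_pos : ∀ n, 0 < t n) {b : ℝ} {K : ℕ} (hb₀ : 0 < b)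
    (hb₁ : b ≤ 1) (hK : 1 ≤ K) (hKb : K * b ≤ (1 / 3000) ^ 2)
    (hphase : ∀ y : ℝ, ∃ n, t n ≤ b ∧ ∃ m : ℤ, |y + t n / b - m| ≤ 1 / (16 * K)) :
    ∃ g : L2, ‖g‖ ^ 2 ≤ 10 * volume.real (Metric.ball (0 : 𝔼) 1) * ((K / b) ^ s / K) ∧
      ∀ᵐ x : 𝔼, ‖x‖ ≤ 1 / 100 → ∃ n, volume.real (Metric.ball (0 : 𝔼) 1) / 4
        ≤ ‖schrodingerMean (signedSymbol ε) (t n) (besselOp hs₀ g) x‖ := by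
  have hij : i ≠ j := fun h => by rw [h, hj] at hi; exact absurd hi (by decide)
  have hpi := Real.pi_gt_three
  have hpi315 := Real.pi_lt_d2
  have hK1 : (1 : ℝ) ≤ K := by exact_mod_cast hK
  have hK0 : (0 : ℝ) < K := by linarith
  -- Up to constants this is the least frequency size for which `K` steps of length `M`, itself of
  -- order `1 / (b * l)`, fit within length `l`.
  set l := Real.sqrt (K / b) with hl
  have hl2 : l ^ 2 = K / b := Real.sq_sqrt (by positivity)
  have hlb : b * l ^ 2 = K := by rw [hl2]; field_simp
  have hl1 : 1 ≤ l := Real.one_le_sqrt.2 (by rw [le_div_iff₀ hb₀]; linarith)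
  have hl0 : 0 < l := by linarith
  have hbl : b * l ≤ 1 / 3000 := by
    refine le_of_sq_le_sq ?_ (by norm_num)
    calc (b * l) ^ 2 = K * b := by rw [← hlb]; ring
      _ ≤ _ := hKb
  have hbl0 : 0 < b * l := by positivity
  -- With this spacing the symbol at `2πθ k`, multiplied by `t n`, equals `2πk * (t n / b)`, so
  -- times up to `b` sweep one full period. `M ≥ 2` keeps the unit balls disjoint.
  set M := 1 / (8 * Real.pi * (b * l)) with hM
  have hM2 : 2 ≤ M := by
    rw [hM, le_div_iff₀ (by positivity)]
    nlinarith
  have hMbl : M * (8 * Real.pi * (b * l)) = 1 := by rw [hM]; field_simp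
  have hKM : K * M ≤ l := by
    have : K * M = l / (8 * Real.pi) := by
      rw [hM, ← hlb]; field_simp
    rw [this, div_le_iff₀ (by positivity)]
    nlinarith
  set θ : ℕ → 𝔼 := fun k => nullFreq i j (k * M) l with hθ
  have hθn : ∀ k < K, ‖θ k‖ ≤ 2 * l := by
    intro k hk
    have hk' : (k : ℝ) ≤ K := by exact_mod_cast hk.le
    refine norm_nullFreq_le i j (by positivity) (le_trans ?_ hKM)
    gcongr
  set U : Set 𝔼 := ⋃ k ∈ Finset.range K, Metric.ball (θ k) 1 with hU
  have hUm : MeasurableSet U := Finset.measurableSet_biUnion _ fun k _ => measurableSet_ball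
  have hUvol : volume U = K * volume (Metric.ball (0 : 𝔼) 1) := by
    rw [hU, measure_biUnion_finset]
    · simp_rw [Measure.addHaar_ball_center]
      simp
    · intro k _ k' _ hkk
      refine Metric.ball_disjoint_ball ?_
      have h1 : (1 : ℝ) ≤ |(k : ℝ) - k'| := by
        have : (1 : ℤ) ≤ |(k : ℤ) - k'| := Int.one_le_abs (sub_ne_zero.2 (by exact_mod_cast hkk))
        exact_mod_cast this
      have h2 := le_norm_nullFreq_sub hij (k * M) (k' * M) l
      rw [← sub_mul, abs_mul, abs_of_pos (by linarith : 0 < M)] at h2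
      rw [dist_eq_norm]
      change _ ≤ ‖nullFreq i j (k * M) l - nullFreq i j (k' * M) l‖
      nlinarith
    · exact fun k _ => measurableSet_ball
  set V := volume.real (Metric.ball (0 : 𝔼) 1) with hV
  have hUf : volume U ≠ ⊤ := by
    rw [hUvol]
    exact ENNReal.mul_ne_top (by simp) measure_ball_lt_top.ne
  have hUV : volume.real U = K * V := by
    rw [measureReal_def, hUvol, ENNReal.toReal_mul, ENNReal.toReal_natCast]
    rfl
  have hUmem : ∀ ξ ∈ U, ∃ k < K, ‖ξ - θ k‖ < 1 := by
    intro ξ hξ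
    simp only [hU, Set.mem_iUnion, Finset.mem_range, Metric.mem_ball, dist_eq_norm] at hξ
    obtain ⟨k, hk, h⟩ := hξ
    exact ⟨k, hk, h⟩
  have hUn : ∀ ξ ∈ U, 1 + ‖ξ‖ ^ 2 ≤ 10 * l ^ 2 := by
    intro ξ hξ
    obtain ⟨k, hk, h⟩ := hUmem ξ hξ
    have h1 : ‖ξ‖ ≤ 3 * l := by
      have := norm_le_norm_add_norm_sub' ξ (θ k)
      have := hθn k hk
      linarith
    nlinarith [norm_nonneg ξ]
  set F : 𝔼 → ℂ := fun ξ => (((1 + ‖ξ‖ ^ 2) ^ (s / 2) * (K : ℝ)⁻¹ : ℝ) : ℂ) with hF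
  have hFc : Continuous F := Complex.continuous_ofReal.comp
    ((Continuous.rpow_const (by fun_prop) fun ξ => Or.inl (by positivity)).mul_const _)
  have hFb : ∀ ξ ∈ U, ‖F ξ‖ ≤ (10 * l ^ 2) ^ (s / 2) / K := by
    intro ξ hξ
    rw [hF, Complex.norm_real, Real.norm_eq_abs, abs_of_nonneg (by positivity),
      ← div_eq_mul_inv]
    gcongr
    exact hUn ξ hξ
  have hg := memLp_indicator_of_bound hUm hUf hFc.aestronglyMeasurable hFb 2
  refine ⟨hg.toLp _, ?_, ?_⟩
  · refine (norm_sq_toLp_indicator_le hUm hUf (by positivity) hFb hg).trans ?_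
    have e1 : ((10 * l ^ 2) ^ (s / 2) / K) ^ 2 * (K * V) = 10 ^ s * (V * ((K / b) ^ s / K)) := by
      rw [div_pow, ← Real.rpow_mul_natCast (by positivity), hl2, Real.mul_rpow (by norm_num)
        (by positivity)]
      push_cast
      rw [div_mul_cancel₀ s two_ne_zero]
      field_simp
    rw [hUV, e1, mul_assoc]
    gcongr
    calc (10 : ℝ) ^ s ≤ 10 ^ (1 : ℝ) := Real.rpow_le_rpow_of_exponent_le (by norm_num) hs₁
      _ = 10 := Real.rpow_one _
  have hrep : ∀ᵐ x : 𝔼, ∀ n, schrodingerMean (signedSymbol ε) (t n) (besselOp hs₀ (hg.toLp _)) x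
      = (((K : ℝ)⁻¹ : ℝ) : ℂ) * ∫ ξ in U, Complex.exp (Complex.I *
        ((2 * Real.pi * inner ℝ ξ x + t n * signedSymbol ε ((2 * Real.pi) • ξ) : ℝ) : ℂ)) :=
    ae_all_iff.2 fun n => ae_schrodingerMean_besselOp_eq _ hs₀ _ hUm hUf _ hg.coeFn_toLp
  filter_upwards [hrep] with x hx hxn
  obtain ⟨n, hnb, z, hz⟩ := hphase (M * (x i + x j))
  refine ⟨n, ?_⟩
  set Φ : 𝔼 → ℝ := fun ξ =>
    2 * Real.pi * inner ℝ ξ x + t n * signedSymbol ε ((2 * Real.pi) • ξ) with hΦ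
  have hnear : ∀ ξ ∈ U, ‖Complex.exp (Complex.I * (Φ ξ : ℝ))
      - Complex.exp (Complex.I * ((2 * Real.pi * (l * (x i - x j)) : ℝ) : ℂ))‖ ≤ 3 / 4 := by
    intro ξ hξ
    obtain ⟨k, hk, hξk⟩ := hUmem ξ hξ
    -- One integer `z` serves all balls: an error of `1 / (16 * K)` per index, multiplied by `k <
    -- K`, stays below `1/16` of a period.
    refine (norm_exp_sub_exp_le _ _ (k * z)).trans ?_
    set ζ := ξ - θ k with hζ
    have hξe : ξ = θ k + ζ := by rw [hζ]; abel
    have hk' : (k : ℝ) ≤ K := by exact_mod_cast hk.le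
    set e₁ := signedSymbol ε (θ k + ζ) - signedSymbol ε (θ k) with he₁
    have e1 : Φ ξ - 2 * Real.pi * (l * (x i - x j)) - 2 * Real.pi * ((k * z : ℤ) : ℝ)
        = 2 * Real.pi * inner ℝ ζ x + t n * ((2 * Real.pi) ^ 2 * e₁)
          + 2 * Real.pi * (k * (M * (x i + x j) + t n / b - z)) := by
      have h1 : signedSymbol ε (θ k + ζ) = e₁ + 4 * (k * M) * l := by
        rw [he₁, hθ, signedSymbol_nullFreq ε hi hj]; ring
      have h2 : t n / b = t n * (M * (8 * Real.pi * l)) := by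
        have : M * (8 * Real.pi * l) = 1 / b := by
          field_simp
          linarith
        rw [this]
        ring
      rw [hΦ, hξe]
      simp only [signedSymbol_smul, inner_add_left]
      rw [h1, hθ, inner_nullFreq, h2]
      push_cast
      ring
    rw [e1]
    -- The three errors, from the position in the ball, the variation of the symbol over it and the
    -- misalignment of the centres, add up to about `0.52 < 3/4`.
    have b1 : |2 * Real.pi * inner ℝ ζ x| ≤ 2 * 3.15 * (1 * (1 / 100)) := by
      rw [abs_mul, abs_of_pos (by positivity : (0 : ℝ) < 2 * Real.pi)]
      gcongr
      exact (abs_real_inner_le_norm _ _).trans (by gcongr)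
    have b2 : |t n * ((2 * Real.pi) ^ 2 * e₁)| ≤ b * ((2 * 3.15) ^ 2 * (5 * l)) := by
      rw [abs_mul, abs_mul, abs_of_pos (ht_pos n), abs_of_pos (by positivity : 0 < (2 * Real.pi) ^ 2)]
      gcongr
      refine (abs_signedSymbol_add_sub_le ε (θ k) ζ).trans ?_
      have := hθn k hk
      nlinarith [norm_nonneg ζ, norm_nonneg (θ k)]
    have b3 : |2 * Real.pi * (k * (M * (x i + x j) + t n / b - z))|
        ≤ 2 * 3.15 * (K * (1 / (16 * K))) := by
      rw [abs_mul (2 * Real.pi), abs_mul (k : ℝ), abs_of_pos (by positivity : (0 : ℝ) < 2 * Real.pi), Nat.abs_cast]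
      gcongr
    have b3' : (K : ℝ) * (1 / (16 * K)) = 1 / 16 := by field_simp
    rw [b3'] at b3
    refine (abs_add_three _ _ _).trans ?_
    nlinarith
  have hψc : Continuous fun ξ : 𝔼 => Complex.exp (Complex.I * (Φ ξ : ℝ)) := by
    have := (signedSymbol ε).continuous
    simp only [hΦ]
    fun_prop
  have hψi : IntegrableOn (fun ξ : 𝔼 => Complex.exp (Complex.I * (Φ ξ : ℝ))) U := by
    refine IntegrableOn.of_bound hUf.lt_top hψc.aestronglyMeasurable 1 (Eventually.of_forall fun ξ => ?_)
    rw [mul_comm, Complex.norm_exp_ofReal_mul_I]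
  have hfin := le_norm_setIntegral_of_near hUf hψi
    (by rw [mul_comm]; exact Complex.norm_exp_ofReal_mul_I _) hnear
  rw [hx n, norm_mul, Complex.norm_real, norm_inv, Real.norm_natCast]
  rw [hUV] at hfin
  rw [inv_mul_eq_div, le_div_iff₀ hK0]
  linarith

theorem memWeakEll_of_forall_ae_tendsto (ε : Fin N → ℤˣ) {i j : Fin N} (hi : ε i = 1) (hj : ε j = -1)
    {s : ℝ} (hs₀ : 0 < s) (hs₁ : s < 1 / 2) {t : ℕ → ℝ} (ht_mem : ∀ n, t n ∈ Set.Ioo (0 : ℝ) 1)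
    (ht_anti : Antitone t) (ht_lim : Tendsto t atTop (𝓝 0))
    (ht_gap : Antitone fun n => t n - t (n + 1))
    (hconv : ∀ f : L2, MemHs s f → ∀ᵐ x,
      Tendsto (fun n => schrodingerMean (signedSymbol ε) (t n) f x) atTop (𝓝 (f x))) :
    MemWeakEll (s / (1 - s)) t := by
  by_contra hw
  -- Composition with the Bessel potential makes the data space the complete space `L²`.
  set A : ℕ → L2 →L[ℂ] L2 := fun n =>
    (schrodingerIsometry (signedSymbol ε) (t n)).toContinuousLinearMap.comp (besselOp hs₀.le) with hA
  have hAbdd : ∀ g, ∀ᵐ x, ∃ C : ℝ, ∀ n, ‖A n g x‖ ≤ C := by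
    intro g
    filter_upwards [hconv _ (memHs_besselOp hs₀.le g)] with x hx
    obtain ⟨C, hC⟩ := hx.norm.bddAbove_range
    exact ⟨C, fun n => hC ⟨n, rfl⟩⟩
  set B : Set 𝔼 := Metric.ball 0 (1 / 100) with hB
  have hBtop : volume B ≠ ⊤ := measure_ball_lt_top.ne
  have hBpos : 0 < volume B := Metric.measure_ball_pos volume 0 (by norm_num)
  obtain ⟨C, hC0, hC⟩ := exists_maximalLE_of_ae_bounded A hAbdd B hBtop (ENNReal.half_pos hBpos.ne')
  set V := volume.real (Metric.ball (0 : 𝔼) 1) with hV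
  have hV0 : 0 < V := ENNReal.toReal_pos (Metric.measure_ball_pos volume 0 one_pos).ne'
    measure_ball_lt_top.ne
  -- Normalising `g` by `η` turns the focused size `V / 4` into at least `2 * C`, above the level
  -- `C` at almost every point of `B`, while Banach's principle allows only half of `B`.
  set η := V / (8 * C) with hη
  have hη0 : 0 < η := by positivity
  obtain ⟨b, K, hb0, hb1, hK, hKb, hKs, hcard⟩ := exists_counterexample_params
    (fun n => (ht_mem n).2) ht_lim hs₀ hs₁ hw (κ := (1 / 3000) ^ 2) (η := η ^ 2 / (10 * V))
    (by norm_num) (by positivity)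
  have hphase : ∀ y : ℝ, ∃ n, t n ≤ b ∧ ∃ m : ℤ, |y + t n / b - m| ≤ 1 / (16 * K) := by
    intro y
    have := exists_phase_near_int ht_anti ht_lim ht_gap hb0 (L := 16 * K) (by omega) hcard y
    simpa using this
  obtain ⟨g, hgn, hgx⟩ := exists_focusing_data ε hi hj hs₀.le (by linarith)
    (fun n => (ht_mem n).1) hb0 hb1 hK hKb hphase
  have hgη : ‖g‖ ≤ η := by
    refine le_of_sq_le_sq (hgn.trans ?_) hη0.le
    rw [le_div_iff₀ (by positivity)] at hKs
    linarith
  have hmax := hC (((η⁻¹ : ℝ) : ℂ) • g) (by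
    rw [norm_smul, Complex.norm_real, Real.norm_eq_abs, abs_of_pos (by positivity),
      inv_mul_le_iff₀ hη0, mul_one]
    exact hgη)
  have hfull : ∀ᵐ x ∂(volume.restrict B), x ∈ {x | ∃ n, C < ‖A n (((η⁻¹ : ℝ) : ℂ) • g) x‖} := by
    have hsm : ∀ᵐ x, ∀ n, A n (((η⁻¹ : ℝ) : ℂ) • g) x = ((η⁻¹ : ℝ) : ℂ) * A n g x := by
      refine ae_all_iff.2 fun n => ?_
      rw [map_smul]
      filter_upwards [Lp.coeFn_smul ((η⁻¹ : ℝ) : ℂ) (A n g)] with x hx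
      rw [hx, Pi.smul_apply, smul_eq_mul]
    rw [ae_restrict_iff' measurableSet_ball]
    filter_upwards [hsm, hgx] with x h1 h2 hxB
    obtain ⟨n, hn⟩ := h2 (by simpa [hB] using (Metric.mem_ball.1 hxB).le)
    refine ⟨n, ?_⟩
    rw [h1, norm_mul, Complex.norm_real, Real.norm_eq_abs, abs_of_pos (by positivity)]
    have hn' : V / 4 ≤ ‖A n g x‖ := hn
    rw [inv_mul_eq_div, lt_div_iff₀ hη0, hη]
    have : C * (V / (8 * C)) = V / 8 := by field_simp
    linarith
  have hle : volume B ≤ volume B / 2 := by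
    rw [← Measure.restrict_apply_univ B]
    exact (measure_mono_ae (hfull.mono fun x hx _ => hx)).trans (hmax.trans_eq (by simp))
  exact absurd hle (not_le.2 (ENNReal.half_lt_self hBpos.ne' hBtop))

end Necessity

end NonellipticSchrodinger

theorem theorem1p3 (N : ℕ) (hN : 2 ≤ N) (ε : Fin N → ℤˣ)
    (hε₁ : ε ⟨0, by omega⟩ = 1) (hε₂ : ε ⟨1, by omega⟩ = -1)
    (s : ℝ) (hs₀ : 0 < s) (hs₁ : s < 1 / 2)
    (t : ℕ → ℝ) (ht_mem : ∀ n, t n ∈ Set.Ioo (0 : ℝ) 1) (ht_anti : Antitone t)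
    (ht_lim : Tendsto t atTop (𝓝 0)) (ht_gap : Antitone fun n => t n - t (n + 1)) :
    (∀ f : Lp ℂ 2 (volume : Measure (EuclideanSpace ℝ (Fin N))),
      NonellipticSchrodinger.MemHs s f →
        ∀ᵐ x : EuclideanSpace ℝ (Fin N),
          Tendsto (fun n => NonellipticSchrodinger.schrodingerMean
            (NonellipticSchrodinger.signedSymbol ε) (t n) f x) atTop (𝓝 (f x))) ↔
      NonellipticSchrodinger.MemWeakEll (s / (1 - s)) t := by
  open NonellipticSchrodinger in
  exact ⟨memWeakEll_of_forall_ae_tendsto ε hε₁ hε₂ hs₀ hs₁ ht_mem ht_anti ht_lim ht_gap,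
    fun hw _ hf => ae_tendsto_of_memWeakEll hs₀ (by linarith) ε ht_mem ht_anti ht_lim hw hf⟩
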